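/- Let $\epsilon=(\epsilon_n)_{n\ge 1}$ be a polynomially small family, that is, $\epsilon_n>0$ for all $n$ and $1/\epsilon_n=O(p(n))$ for some polynomial $p$. Then the restricted quantum computer $\mathrm{QC}_\epsilon$ can solve every problem in BQP in polynomial time. Here $\mathrm{QC}_\epsilon$ is the computer that runs only those circuits of elementary unitary gates, each acting on at most three qubits (with matrix entries in $\mathbb{Q}(e^{i\pi/4})$, given explicitly by rational coordinates whose numerators and denominators are written in unary), for which the following holds: if the circuit acts on an $n$-qubit register, $n\ge 1$, with input $|0\rangle^n$, then at every step of the computation (before the first gate and after each gate) the state $|\psi\rangle$ of the register satisfies $T(|\psi\rangle,|0\rangle^n)\le\epsilon_n$, where $T(|\psi\rangle,|\varphi\rangle)=\tfrac12\big\|\,|\psi\rangle\langle\psi|-|\varphi\rangle\langle\varphi|\,\big\|_1$ is the trace distance. A run ends with a standard basis measurement of the first qubit. A decision problem, possibly with a promise, is given by sets of yes-instances and no-instances in $\{0,1\}^*$ (a language and its complement in the case without promise). It is in BQP if a deterministic Turing machine computes in polynomial time, from each $x\in\{0,1\}^*$, a circuit of Hadamard, $\pi/8$-phase and CNOT gates,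 to be run on $|0\rangle^m$ for some $m\ge 1$, such that the measurement of the first qubit at the end gives $1$ with probability at least $2/3$ if $x$ is a yes-instance and at most $1/3$ if $x$ is a no-instance. It is solved by $\mathrm{QC}_\epsilon$ in polynomial time if there are polynomials $s,r$ and polynomial-time deterministic Turing machines $A,B$ such that, for each $x$, the machine $A$ computes from $x$ the description of a circuit that $\mathrm{QC}_\epsilon$ is allowed to run, with at most $s(n)$ gates if it has $n$ qubits; and such that $B$, given $x$ and the outcomes of $r(|x|)$ independent runs of this circuit, accepts with probability at least $2/3$ if $x$ is a yes-instance and at most $1/3$ if $x$ is a no-instance. -/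

import Mathlib

open Asymptotics Filter

noncomputable section

namespace SmallQC

/-! ### Pure states and elementary gates -/

/-- Amplitudes of a pure state of `n` qubits in the standard basis. -/
abbrev State (n : ℕ) : Type := (Fin n → Bool) → ℂ

/-- Operators on `k` qubits, in the standard basis. -/
abbrev QubitMatrix (k : ℕ) : Type := Matrix (Fin k → Bool) (Fin k → Bool) ℂ

/-- The state `|0⟩^n`. -/
def zeroState (n : ℕ) : State n := Pi.single (fun _ => false) 1

/-- An elementary unitary gate in an `n`-qubit register: a unitary on at most three qubits,
together with the distinct qubits on which it acts. -/
structure Gate (n : ℕ) where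
  arity : ℕ
  arity_le : arity ≤ 3
  wires : Fin arity ↪ Fin n
  mat : QubitMatrix arity
  unitary : mat ∈ Matrix.unitaryGroup (Fin arity → Bool) ℂ

/-- The action of a gate on the register (identity on the qubits that are not wires of the gate):
`Function.extend g.wires y x` is the bit string `x` with the bits on the wires replaced by `y`. -/
def Gate.apply {n : ℕ} (g : Gate n) (ψ : State n) : State n := fun x =>
  ∑ y : Fin g.arity → Bool, g.mat (x ∘ g.wires) y * ψ (Function.extend g.wires y x)

/-- The state obtained from `|0⟩^n` by applying the gates of the list from left to right. -/
def finalState {n : ℕ} (gs : List (Gate n)) : State n :=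
  gs.foldl (fun ψ g => g.apply ψ) (zeroState n)

/-- Probability of the outcome `1` when qubit `i` is measured in the standard basis. -/
def probOne {n : ℕ} (ψ : State n) (i : Fin n) : ℝ :=
  ∑ x : Fin n → Bool, if x i then ‖ψ x‖ ^ 2 else 0

/-! ### Trace distance and the neighbourhood of `|0⟩^n` -/

/-- The trace norm: the sum of the singular values, which are the square roots of the eigenvalues
of `Aᴴ * A`. -/
def traceNorm {ι : Type} [Fintype ι] [DecidableEq ι] (A : Matrix ι ι ℂ) : ℝ :=
  ∑ i, Real.sqrt ((Matrix.isHermitian_conjTranspose_mul_self A).eigenvalues i)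

/-- The density operator `|ψ⟩⟨ψ|`. -/
def density {n : ℕ} (ψ : State n) : QubitMatrix n := Matrix.vecMulVec ψ (star ψ)

/-- The trace distance of two pure states. -/
def traceDist {n : ℕ} (ψ φ : State n) : ℝ := (1 / 2) * traceNorm (density ψ - density φ)

/-- The set of `n`-qubit states that are `ε`-close to `|0⟩^n` in trace distance. -/
def nearZero (n : ℕ) (ε : ℝ) : Set (State n) :=
  {ψ | ∑ x, ‖ψ x‖ ^ 2 = 1 ∧ traceDist ψ (zeroState n) ≤ ε}

/-- `ε 1, ε 2, …` are positive and `1 / ε n = O(p n)` for some polynomial `p`. -/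
def PolynomiallySmall (ε : ℕ → ℝ) : Prop :=
  (∀ n, 1 ≤ n → 0 < ε n) ∧
    ∃ p : Polynomial ℝ, (fun n : ℕ => 1 / ε n) =O[atTop] fun n : ℕ => p.eval (n : ℝ)

/-! ### Gates and circuits with finite descriptions -/

/-- The Hadamard gate. -/
def hadamard : QubitMatrix 1 := fun x y =>
  (if x 0 && y 0 then -1 else 1) / ((Real.sqrt 2 : ℝ) : ℂ)

/-- The number `exp (i π / 4)`. -/
def zeta : ℂ := Complex.exp (((Real.pi / 4 : ℝ) : ℂ) * Complex.I)

/-- The `π / 8` phase gate `diag (1, exp (i π / 4))`. -/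
def phaseT : QubitMatrix 1 := Matrix.diagonal fun x => if x 0 then zeta else 1

/-- The CNOT gate; qubit `0` is the control, qubit `1` the target. -/
def cnot : QubitMatrix 2 := fun x y =>
  if x 0 = y 0 ∧ x 1 = xor (y 0) (y 1) then 1 else 0

/-- A letter of the universal gate set: a Hadamard, `π / 8` phase or CNOT gate on given qubits. -/
inductive StdGate (n : ℕ) : Type
  | h (i : Fin n)
  | t (i : Fin n)
  | cx (control target : Fin n) (ne : control ≠ target)

lemma hadamard_unitary : hadamard ∈ Matrix.unitaryGroup (Fin 1 → Bool) ℂ := by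
  have hs : ((Real.sqrt 2 : ℝ) : ℂ) * ((Real.sqrt 2 : ℝ) : ℂ) = 2 := by
    rw [← Complex.ofReal_mul, Real.mul_self_sqrt (by norm_num)]; norm_num
  have h0 : ((Real.sqrt 2 : ℝ) : ℂ) ≠ 0 := by
    intro h
    rw [h] at hs
    norm_num at hs
  rw [Matrix.mem_unitaryGroup_iff]
  ext x y
  rw [Matrix.mul_apply, ← (Equiv.funUnique (Fin 1) Bool).symm.sum_comp]
  have hxy : x = y ↔ x 0 = y 0 := by
    constructor
    · rintro rfl; rfl
    · intro h; funext i; rw [Subsingleton.elim i 0]; exact h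
  rw [Matrix.one_apply]
  simp only [hxy]
  cases hx : x 0 <;> cases hy : y 0 <;>
    simp [hadamard, hx, hy, Matrix.star_apply, Equiv.funUnique] <;> field_simp <;>
    first | done | (rw [pow_two, hs]; try norm_num)

lemma phaseT_unitary : phaseT ∈ Matrix.unitaryGroup (Fin 1 → Bool) ℂ := by
  have hz : zeta * star zeta = 1 := by
    rw [Complex.star_def, Complex.mul_conj, Complex.normSq_eq_norm_sq, zeta,
      Complex.norm_exp_ofReal_mul_I]
    norm_num
  rw [Matrix.mem_unitaryGroup_iff, Matrix.star_eq_conjTranspose, phaseT,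
    Matrix.diagonal_conjTranspose, Matrix.diagonal_mul_diagonal, ← Matrix.diagonal_one]
  congr 1
  funext x
  by_cases h : x 0 = true
  · simpa [h] using hz
  · simp [h]

lemma cnot_unitary : cnot ∈ Matrix.unitaryGroup (Fin 2 → Bool) ℂ := by
  rw [Matrix.mem_unitaryGroup_iff]
  ext x y
  rw [Matrix.mul_apply, ← (finTwoArrowEquiv Bool).symm.sum_comp, Fintype.sum_prod_type]
  have hxy : x = y ↔ x 0 = y 0 ∧ x 1 = y 1 := by
    constructor
    · rintro rfl; exact ⟨rfl, rfl⟩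
    · rintro ⟨h0, h1⟩; funext i; fin_cases i; exacts [h0, h1]
  rw [Matrix.one_apply]
  simp only [hxy]
  cases hx : x 0 <;> cases hx1 : x 1 <;> cases hy : y 0 <;> cases hy1 : y 1 <;>
    simp [cnot, hx, hy, hx1, hy1, Matrix.star_apply, finTwoArrowEquiv]

/-- One-qubit wire. -/
def wire1 {n : ℕ} (i : Fin n) : Fin 1 ↪ Fin n :=
  ⟨fun _ => i, fun a b _ => Subsingleton.elim a b⟩

/-- Two distinct wires. -/
def wire2 {n : ℕ} (i j : Fin n) (ne : i ≠ j) : Fin 2 ↪ Fin n :=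
  ⟨![i, j], by
    intro a b hab
    fin_cases a <;> fin_cases b <;> simp_all [eq_comm]⟩

/-- The gate denoted by a letter of the universal gate set. -/
def StdGate.toGate {n : ℕ} : StdGate n → Gate n
  | .h i => ⟨1, by norm_num, wire1 i, hadamard, hadamard_unitary⟩
  | .t i => ⟨1, by norm_num, wire1 i, phaseT, phaseT_unitary⟩
  | .cx c d ne => ⟨2, by norm_num, wire2 c d ne, cnot, cnot_unitary⟩

/-- The element `c₀ + c₁ ζ + c₂ ζ² + c₃ ζ³` of the field `ℚ(ζ)`, `ζ = exp (i π / 4)`. -/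
def cyclo (c : Fin 4 → ℚ) : ℂ := ∑ j : Fin 4, (c j : ℂ) * zeta ^ (j : ℕ)

/-- A unitary gate on at most three qubits, given explicitly by its matrix, whose entries are in
the field `ℚ(exp (i π / 4))`. -/
structure ExactGate (n : ℕ) where
  arity : ℕ
  arity_le : arity ≤ 3
  wires : Fin arity ↪ Fin n
  coeff : (Fin arity → Bool) → (Fin arity → Bool) → Fin 4 → ℚ
  unitary : (Matrix.of fun x y => cyclo (coeff x y)) ∈
    Matrix.unitaryGroup (Fin arity → Bool) ℂ

/-- The gate denoted by an exact description. -/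
def ExactGate.toGate {n : ℕ} (g : ExactGate n) : Gate n :=
  ⟨g.arity, g.arity_le, g.wires, Matrix.of fun x y => cyclo (g.coeff x y), g.unitary⟩

/-- A circuit on a register of at least one qubit, with gates described by `G`. -/
structure Circuit (G : ℕ → Type) where
  numQubits : ℕ
  pos : 0 < numQubits
  gates : List (G numQubits)

/-! ### Circuits as bit strings -/

/-- Self-delimiting unary code of a natural number. -/
def codeNat (a : ℕ) : List Bool := List.replicate a true ++ [false]

/-- Self-delimiting code of a rational number: sign, numerator, denominator. -/
def codeRat (r : ℚ) : List Bool :=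
  decide (r < 0) :: (codeNat r.num.natAbs ++ codeNat r.den)

/-- All bit strings of length `k`, in the order of the binary numbers. -/
def bitStrings (k : ℕ) : List (Fin k → Bool) :=
  (List.range (2 ^ k)).map fun j i => j.testBit i

/-- Code of a letter of the universal gate set. -/
def StdGate.code {n : ℕ} : StdGate n → List Bool
  | .h i => codeNat 0 ++ codeNat i
  | .t i => codeNat 1 ++ codeNat i
  | .cx c d _ => codeNat 2 ++ codeNat c ++ codeNat d

/-- Code of an exactly described gate: the arity, the wires, and the matrix entries. -/
def ExactGate.code {n : ℕ} (g : ExactGate n) : List Bool :=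
  codeNat g.arity ++ (List.ofFn fun i => (g.wires i : ℕ)).flatMap codeNat ++
    (bitStrings g.arity).flatMap fun x => (bitStrings g.arity).flatMap fun y =>
      (List.ofFn (g.coeff x y)).flatMap codeRat

/-- Code of a circuit: the number of qubits in unary, then the gates in their order. -/
def Circuit.code {G : ℕ → Type} (gc : ∀ n, G n → List Bool) (C : Circuit G) : List Bool :=
  codeNat C.numQubits ++ C.gates.flatMap (fun g => true :: gc C.numQubits g) ++ [false]

/-- Code of an input string together with a list of measurement outcomes. -/
def codePair (p : List Bool × List Bool) : List (Bool ⊕ Bool) :=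
  p.1.map Sum.inl ++ p.2.map Sum.inr

/-! ### BQP and the restricted quantum computer -/

/-- The probability that measuring the first qubit after the circuit, run on `|0⟩^n`, gives `1`. -/
def Circuit.accProb {G : ℕ → Type} (den : ∀ n, G n → Gate n) (C : Circuit G) : ℝ :=
  probOne (finalState (C.gates.map (den C.numQubits))) ⟨0, C.pos⟩

/-- The decision problem with yes-instances `yes` and no-instances `no` is in BQP: some
deterministic Turing machine computes in polynomial time from every input `x` a
Hadamard, `π / 8`, CNOT circuit which accepts with probability at least `2 / 3` if `x ∈ yes` and
at most `1 / 3` if `x ∈ no`. A language `L` is the case `yes = L`, `no = Lᶜ`. -/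
def InBQP (yes no : Set (List Bool)) : Prop :=
  ∃ circ : List Bool → Circuit StdGate,
    Nonempty (Turing.TM2ComputableInPolyTime (id : List Bool → List Bool)
      (Circuit.code fun _ g => g.code) circ) ∧
    (∀ x ∈ yes, 2 / 3 ≤ (circ x).accProb fun _ g => g.toGate) ∧
    (∀ x ∈ no, (circ x).accProb (fun _ g => g.toGate) ≤ 1 / 3)

/-- The circuits that the restricted quantum computer `QC_ε` may run: at every step of the
computation (before the first gate and after each gate) the state of the `n`-qubit register is
`ε n`-close to `|0⟩^n` in trace distance. -/
def QC (ε : ℕ → ℝ) : Set (Circuit ExactGate) :=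
  {C | ∀ t ≤ C.gates.length,
    finalState ((C.gates.take t).map ExactGate.toGate) ∈ nearZero C.numQubits (ε C.numQubits)}

/-- The probability that the sequence of outcomes of `N` independent runs, each of which gives `1`
with probability `q`, satisfies the test `post`. -/
def probRuns (q : ℝ) (N : ℕ) (post : List Bool → Bool) : ℝ :=
  ∑ o : Fin N → Bool,
    if post (List.ofFn o) then ∏ i, (if o i then q else 1 - q) else 0

/-- The decision problem `(yes, no)` can be solved with bounded error in polynomial time by an
algorithm with access to `QC_ε`: on input `x`, a deterministic Turing machine computes in
polynomial time a circuit that is allowed in `QC_ε` and has a number of gates polynomial in its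
number `n` of qubits, the circuit is run on `QC_ε` a number of times that is polynomial in the
length of `x`, each run followed by the measurement of the first qubit, and a deterministic Turing
machine computes the answer in polynomial time from `x` and the outcomes. -/
def SolvableByQC (ε : ℕ → ℝ) (yes no : Set (List Bool)) : Prop :=
  ∃ (circ : List Bool → Circuit ExactGate) (size runs : Polynomial ℕ)
    (post : List Bool × List Bool → Bool),
    Nonempty (Turing.TM2ComputableInPolyTime (id : List Bool → List Bool)
      (Circuit.code fun _ g => g.code) circ) ∧
    Nonempty (Turing.TM2ComputableInPolyTime codePair Computability.encodeBool post) ∧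
    (∀ x, circ x ∈ QC ε) ∧
    (∀ x, (circ x).gates.length ≤ size.eval (circ x).numQubits) ∧
    (∀ x ∈ yes, 2 / 3 ≤ probRuns ((circ x).accProb fun _ g => g.toGate)
      (runs.eval x.length) fun o => post (x, o)) ∧
    (∀ x ∈ no, probRuns ((circ x).accProb fun _ g => g.toGate)
      (runs.eval x.length) (fun o => post (x, o)) ≤ 1 / 3)

end SmallQC

end

open Asymptotics Filter

noncomputable section

namespace SmallQC

open Turing

/-! ### Runs of stack machines -/

/-! The computation is hidden in a branch of small amplitude. Given a circuit `C` on `m` qubits with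
`g` gates, add a control qubit, turn it from `|0⟩` to `α|0⟩ + β|1⟩` with `β` small, and then run
every gate of `C` controlled by it. At each time the state is `α|0…0⟩ + β|1⟩|ψ_t⟩`, with `ψ_t` the
state of `C` (`StdGate.ctrl_apply_branchState`, `rotation_apply_zeroState`). Its overlap with
`|0…0⟩` is always `α`, so its trace distance to `|0…0⟩` is at most `√(1 - |α|²) = |β|`
(`traceDist_zeroState_le`). Controlling a gate on at most two qubits gives one on at most three.

The `|0…0⟩` branch never yields the outcome `1`, so the acceptance probability `p` of `C` becomes
`|β|² p` (`accProb_smallCircuit`). With `|β|² = 1 / (N² + 1)` and `72 (N² + 1)` runs, the expected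
number of outcomes `1` is `72 p`: at least `48` for yes-instances, at most `24` for no-instances. By
Chebyshev the threshold `36` errs with probability at most `1/3`.

Take `N = (|x| + 2) ^ j`. As `1 / ε n` is bounded by a polynomial in `n`, and the number of qubits
by one in `|x|`, a large `j` gives `1 / N ≤ ε n`. Thus `N` is known from `|x|` alone, and the number
of runs is exactly a polynomial in `|x|`. Adding `g` idle qubits makes the number of gates, `g + 1`,
at most the number of qubits.

The rest is computability. A small language of stack programs is built with time bounds, and
`polyTime_of_wrap` runs such programs before and after a given polynomial-time machine. The program
after it rewrites the code of `C` into that of the new circuit: it shifts the wires, inserts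
constant matrices, and writes the rotation, whose entries have unary numerators and denominators
that are polynomials in `N`. -/

/-- `Steps m t c d`: the stack program `m` goes from `c` to `d` in exactly `t` steps. -/
inductive Steps {K : Type} [DecidableEq K] {Γ : K → Type} {Λ σ : Type}
    (m : Λ → TM2.Stmt Γ Λ σ) : ℕ → TM2.Cfg Γ Λ σ → TM2.Cfg Γ Λ σ → Prop
  | refl (c) : Steps m 0 c c
  | head {t l v S d} : Steps m t (TM2.stepAux (m l) v S) d → Steps m (t + 1) ⟨some l, v, S⟩ d

section

variable {K : Type} [DecidableEq K] {Γ : K → Type} {Λ σ : Type}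

lemma Steps.trans {m : Λ → TM2.Stmt Γ Λ σ} {s t : ℕ} {a b c : TM2.Cfg Γ Λ σ}
    (h₁ : Steps m s a b) (h₂ : Steps m t b c) : Steps m (s + t) a c := by
  induction h₁ with
  | refl => simpa using h₂
  | head _ ih => rw [Nat.add_right_comm]; exact .head (ih h₂)

lemma Steps.single {m : Λ → TM2.Stmt Γ Λ σ} {l v S d} (h : TM2.stepAux (m l) v S = d) :
    Steps m 1 ⟨some l, v, S⟩ d :=
  .head (h ▸ .refl _)

/-- A step-by-step simulation. -/
lemma Steps.simulate {K' : Type} [DecidableEq K'] {Γ' : K' → Type} {Λ' σ' : Type}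
    {m : Λ → TM2.Stmt Γ Λ σ} {m' : Λ' → TM2.Stmt Γ' Λ' σ'}
    (Φ : TM2.Cfg Γ Λ σ → TM2.Cfg Γ' Λ' σ')
    (hΦ : ∀ l v S, Steps m' 1 (Φ ⟨some l, v, S⟩) (Φ (TM2.stepAux (m l) v S)))
    {t : ℕ} {c d : TM2.Cfg Γ Λ σ} (h : Steps m t c d) : Steps m' t (Φ c) (Φ d) := by
  induction h with
  | refl => exact .refl _
  | head _ ih => rw [Nat.add_comm]; exact (hΦ _ _ _).trans ih

/-- A halted configuration has no successor, and an undefined iterate remains undefined; hence an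
iterate with a value has not met a halted configuration before its last one. -/
lemma Steps.of_iterate {m : Λ → TM2.Stmt Γ Λ σ} {t : ℕ} {c d : TM2.Cfg Γ Λ σ}
    (h : (flip Bind.bind (TM2.step m))^[t] (some c) = some d) : Steps m t c d := by
  induction t generalizing c with
  | zero =>
    obtain rfl : c = d := by simpa using h
    exact .refl _
  | succ t ih =>
    rw [Function.iterate_succ_apply] at h
    obtain ⟨l, v, S⟩ := c
    cases l with
    | none =>
      have hn : ∀ s, (flip Bind.bind (TM2.step m))^[s] (none : Option (TM2.Cfg Γ Λ σ)) = none :=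
        fun s => Function.iterate_fixed rfl s
      exact absurd ((hn t).symm.trans h) (by simp)
    | some l => exact .head (ih h)

lemma Steps.iterate {m : Λ → TM2.Stmt Γ Λ σ} {t : ℕ} {c d : TM2.Cfg Γ Λ σ}
    (h : Steps m t c d) : (flip Bind.bind (TM2.step m))^[t] (some c) = some d := by
  induction h with
  | refl => rfl
  | head _ ih => rw [Function.iterate_succ_apply]; exact ih

/-- Renaming of the labels of a statement by `f`, where halting is replaced by a jump to `e`
(or kept, if `e = none`). -/
def relabel {Λ' : Type} (f : Λ → Λ') (e : Option Λ') : TM2.Stmt Γ Λ σ → TM2.Stmt Γ Λ' σ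
  | .push k a q => .push k a (relabel f e q)
  | .peek k a q => .peek k a (relabel f e q)
  | .pop k a q => .pop k a (relabel f e q)
  | .load a q => .load a (relabel f e q)
  | .branch p q₁ q₂ => .branch p (relabel f e q₁) (relabel f e q₂)
  | .goto g => .goto fun v => f (g v)
  | .halt => e.elim .halt fun l => .goto fun _ => l

/-- Labels occur only where a statement ends, so relabelling changes nothing but the label of the
resulting configuration. -/
lemma stepAux_relabel {Λ' : Type} (f : Λ → Λ') (e : Option Λ') (q : TM2.Stmt Γ Λ σ) (v : σ)
    (S : ∀ k, List (Γ k)) :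
    TM2.stepAux (relabel f e q) v S =
      ⟨(TM2.stepAux q v S).l.elim e fun l => some (f l), (TM2.stepAux q v S).var,
        (TM2.stepAux q v S).stk⟩ := by
  induction q generalizing v S with
  | push k a q ih => exact ih _ _
  | peek k a q ih => exact ih _ _
  | pop k a q ih => exact ih _ _
  | load a q ih => exact ih _ _
  | branch p q₁ q₂ ih₁ ih₂ =>
    simp only [relabel, TM2.stepAux]
    cases p v
    · exact ih₂ _ _
    · exact ih₁ _ _
  | goto g => rfl
  | halt => cases e <;> rfl

end

/-! ### Program fragments -/

/-- A stack program with an entry label, to be combined with others; it ends by halting. -/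
structure Frag {K : Type} (Γ : K → Type) (σ : Type) where
  Λ : Type
  fin : Fintype Λ
  entry : Λ
  code : Λ → TM2.Stmt Γ Λ σ

namespace Frag

variable {K : Type} [DecidableEq K] {Γ : K → Type} {σ : Type}

/-- The fragment turns the variable `v` and the stacks `S` into `v'` and `S'` in time `T`. -/
def Runs (F : Frag Γ σ) (v : σ) (S : ∀ k, List (Γ k)) (v' : σ) (S' : ∀ k, List (Γ k))
    (T : ℕ) : Prop :=
  ∃ t ≤ T, Steps F.code t ⟨some F.entry, v, S⟩ ⟨none, v', S'⟩

lemma Runs.mono {F : Frag Γ σ} {v v' : σ} {S S' : ∀ k, List (Γ k)} {T T' : ℕ}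
    (h : F.Runs v S v' S' T) (hT : T ≤ T') : F.Runs v S v' S' T' := by
  obtain ⟨t, ht, h⟩ := h
  exact ⟨t, ht.trans hT, h⟩

/-- A fragment of one statement. -/
def single (q : TM2.Stmt Γ Unit σ) : Frag Γ σ := ⟨Unit, inferInstance, (), fun _ => q⟩

/-- Sequential composition. -/
def seq (F G : Frag Γ σ) : Frag Γ σ where
  Λ := F.Λ ⊕ G.Λ
  fin := by
    haveI := F.fin
    haveI := G.fin
    exact inferInstance
  entry := Sum.inl F.entry
  code := Sum.elim (fun l => relabel Sum.inl (some (Sum.inr G.entry)) (F.code l))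
    fun l => relabel Sum.inr none (G.code l)

/-- Both runs are lifted by `Steps.simulate`. The halted configuration of `F` is mapped to the entry
of `G`, so the junction costs no step. -/
lemma Runs.seq {F G : Frag Γ σ} {v₁ v₂ v₃ : σ} {S₁ S₂ S₃ : ∀ k, List (Γ k)} {T₁ T₂ : ℕ}
    (h₁ : F.Runs v₁ S₁ v₂ S₂ T₁) (h₂ : G.Runs v₂ S₂ v₃ S₃ T₂) :
    (F.seq G).Runs v₁ S₁ v₃ S₃ (T₁ + T₂) := by
  obtain ⟨t₁, ht₁, h₁⟩ := h₁
  obtain ⟨t₂, ht₂, h₂⟩ := h₂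
  refine ⟨t₁ + t₂, Nat.add_le_add ht₁ ht₂, ?_⟩
  have k₁ := h₁.simulate (m' := (F.seq G).code)
    (fun c => ⟨c.l.elim (some (Sum.inr G.entry)) fun l => some (Sum.inl l), c.var, c.stk⟩)
    fun l v S => Steps.single (stepAux_relabel _ _ _ _ _)
  have k₂ := h₂.simulate (m' := (F.seq G).code)
    (fun c => ⟨c.l.elim none fun l => some (Sum.inr l), c.var, c.stk⟩)
    fun l v S => Steps.single (stepAux_relabel _ _ _ _ _)
  exact k₁.trans k₂

/-- Move the stack `k` to the stack `k'`, where the symbols are translated into values of the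
variable by `r` (which tells that the stack is empty if `more` is false) and back by `w`. -/
def transfer (k k' : K) (r : σ → Option (Γ k) → σ) (more : σ → Bool) (w : σ → Γ k') :
    Frag Γ σ :=
  single (.pop k r (.branch more (.push k' w (.goto fun _ => ())) .halt))

/-- The variable is the buffer between two stacks with possibly different alphabets. The invariant
`I` records what the buffering does not disturb; in the application, that the called machine's own
variable is initial. The extra step finds the stack empty. -/
lemma transfer_runs {k k' : K} (hk : k ≠ k') {r : σ → Option (Γ k) → σ} {more : σ → Bool}
    {w : σ → Γ k'} (f : Γ k → Γ k') (I : σ → Prop)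
    (hr : ∀ v o, I v → I (r v o) ∧ more (r v o) = o.isSome ∧ ∀ a ∈ o, w (r v o) = f a)
    (v : σ) (hv : I v) (S : ∀ k, List (Γ k)) :
    ∃ v', I v' ∧ (transfer k k' r more w).Runs v S v'
      (Function.update (Function.update S k []) k' (((S k).map f).reverse ++ S k'))
      ((S k).length + 1) := by
  generalize hl : S k = l
  induction l generalizing v S with
  | nil =>
    refine ⟨r v none, (hr v none hv).1, 1, by simp, Steps.single ?_⟩
    have h2 := (hr v none hv).2.1
    change TM2.stepAux ((transfer k k' r more w).code ()) v S = _
    simp only [transfer, single, TM2.stepAux, hl, List.head?_nil, h2, Option.isSome_none,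
      cond_false, List.tail_nil, List.map_nil, List.reverse_nil, List.nil_append]
    congr 1
    funext j
    by_cases hj : j = k'
    · subst hj; simp [Function.update_of_ne hk.symm]
    · simp [Function.update_of_ne hj]
  | cons a l ih =>
    obtain ⟨i1, i2, i3⟩ := hr v (some a) hv
    obtain ⟨v', hv', t, ht, hs⟩ := ih (r v (some a)) i1
      (Function.update (Function.update S k l) k' (f a :: S k')) (by
        rw [Function.update_of_ne hk, Function.update_self])
    refine ⟨v', hv', t + 1, by simpa using ht, .head ?_⟩
    have e : TM2.stepAux ((transfer k k' r more w).code ()) v S =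
        ⟨some (), r v (some a), Function.update (Function.update S k l) k' (f a :: S k')⟩ := by
      simp only [transfer, single, TM2.stepAux, hl, List.head?_cons, i2, Option.isSome_some,
        cond_true, List.tail_cons, i3 a rfl]
      rw [Function.update_of_ne hk.symm]
    have e2 : Function.update (Function.update (Function.update (Function.update S k l) k'
        (f a :: S k')) k []) k' ((l.map f).reverse ++ Function.update (Function.update S k l) k'
        (f a :: S k') k') =
        Function.update (Function.update S k []) k' (((a :: l).map f).reverse ++ S k') := by
      funext j
      by_cases hj : j = k'
      · subst hj; simp
      · by_cases hj' : j = k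
        · subst hj'; simp [hk]
        · simp [hj, hj']
    change Steps _ t (TM2.stepAux ((transfer k k' r more w).code ()) v S) _
    rw [e, ← e2]
    exact hs

end Frag

/-! ### Programs for stacks of bits -/

/-- Programs whose stacks, indexed by `R`, consist of bits, with one variable, which holds the
result of the last removal of a bit from a stack. -/
abbrev Prog (R : Type) : Type 1 := Frag (fun _ : R => Bool) (Option Bool)

namespace Prog

variable {R : Type} [DecidableEq R]

/-- The program turns the stacks `S` into `S'` in time `T`, whatever the value of the variable. -/
def Does (F : Prog R) (S S' : R → List Bool) (T : ℕ) : Prop :=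
  ∀ v, ∃ v', Frag.Runs F v S v' S' T

lemma Does.mono {F : Prog R} {S S' : R → List Bool} {T T' : ℕ}
    (h : Does F S S' T) (hT : T ≤ T') : Does F S S' T' := fun v =>
  (h v).imp fun _ h => h.mono hT

lemma Does.seq {F G : Prog R} {S₁ S₂ S₃ : R → List Bool} {T₁ T₂ : ℕ}
    (h₁ : Does F S₁ S₂ T₁) (h₂ : Does G S₂ S₃ T₂) : Does (Frag.seq F G) S₁ S₃ (T₁ + T₂) := by
  intro v
  obtain ⟨v₂, h₁⟩ := h₁ v
  obtain ⟨v₃, h₂⟩ := h₂ v₂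
  exact ⟨v₃, h₁.seq h₂⟩

/-- The program that does nothing. -/
def skip : Prog R := Frag.single .halt

lemma skip_does (S : R → List Bool) : Does skip S S 1 :=
  fun v => ⟨v, 1, le_rfl, Steps.single rfl⟩

/-- Put a bit on a stack. -/
def push (k : R) (b : Bool) : Prog R := Frag.single (.push k (fun _ => b) .halt)

lemma push_does (k : R) (b : Bool) (S : R → List Bool) :
    Does (push k b) S (Function.update S k (b :: S k)) 1 :=
  fun v => ⟨v, 1, le_rfl, Steps.single rfl⟩

/-- Remove a bit from the stack `k`, run the program `F o` where `o` is this bit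
(`none` if the stack is empty), and repeat if `cont o` holds. -/
def popLoop (k : R) (cont : Option Bool → Bool) (F : Option Bool → Prog R) : Prog R where
  Λ := Option (Σ o, (F o).Λ)
  fin := by
    haveI := fun o => (F o).fin
    exact inferInstance
  entry := none
  code
    | none => .pop k (fun _ o => o) (.goto fun v => some ⟨v, (F v).entry⟩)
    | some ⟨o, l⟩ =>
      relabel (fun l => some ⟨o, l⟩) (if cont o then some none else none) ((F o).code l)

/-- One round of the loop: a step to remove the bit, then the body chosen by it, whose halting has
become either a jump back to the head or the end of the loop. -/
lemma popLoop_steps {k : R} {cont : Option Bool → Bool} {F : Option Bool → Prog R}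
    {S S' : R → List Bool} {T : ℕ}
    (h : Does (F (S k).head?) (Function.update S k (S k).tail) S' T) (v : Option Bool) :
    ∃ v', ∃ t ≤ T + 1, Steps (popLoop k cont F).code t ⟨some none, v, S⟩
      ⟨if cont (S k).head? then some none else none, v', S'⟩ := by
  obtain ⟨v', t, ht, h⟩ := h (S k).head?
  refine ⟨v', t + 1, by omega, .head ?_⟩
  exact h.simulate (m' := (popLoop k cont F).code)
    (fun c => ⟨c.l.elim (if cont (S k).head? then some none else none)
      fun l => some (some ⟨(S k).head?, l⟩), c.var, c.stk⟩)
    fun l v S => Steps.single (stepAux_relabel _ _ _ _ _)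

lemma popLoop_exit {k : R} {cont : Option Bool → Bool} {F : Option Bool → Prog R}
    {S S' : R → List Bool} {T : ℕ} (o : Option Bool) (ho : (S k).head? = o)
    (hc : cont o = false)
    (h : Does (F o) (Function.update S k (S k).tail) S' T) :
    Does (popLoop k cont F) S S' (T + 1) := by
  subst ho
  intro v
  obtain ⟨v', t, ht, h⟩ := popLoop_steps (cont := cont) h v
  rw [hc] at h
  exact ⟨v', t, ht, h⟩

lemma popLoop_next {k : R} {cont : Option Bool → Bool} {F : Option Bool → Prog R}
    {S S₁ S' : R → List Bool} {T₁ T₂ : ℕ} (o : Option Bool) (ho : (S k).head? = o)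
    (hc : cont o = true)
    (h₁ : Does (F o) (Function.update S k (S k).tail) S₁ T₁)
    (h₂ : Does (popLoop k cont F) S₁ S' T₂) :
    Does (popLoop k cont F) S S' (T₁ + 1 + T₂) := by
  subst ho
  intro v
  obtain ⟨v₁, t₁, ht₁, h₁⟩ := popLoop_steps (cont := cont) h₁ v
  obtain ⟨v', t₂, ht₂, h₂⟩ := h₂ v₁
  rw [hc] at h₁
  exact ⟨v', t₁ + t₂, by omega, h₁.trans h₂⟩

/-- Put a string on a stack, so that its first symbol is on top. -/
def emit (k : R) (w : List Bool) : Prog R :=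
  w.foldr (fun b F => Frag.seq F (push k b)) skip

lemma emit_does (k : R) (w : List Bool) (S : R → List Bool) :
    Does (emit k w) S (Function.update S k (w ++ S k)) (w.length + 1) := by
  induction w with
  | nil => simpa [emit] using skip_does S
  | cons b w ih =>
    have := ih.seq (push_does k b _)
    simp only [Function.update_self, Function.update_idem] at this
    exact this.mono (by simp)

/-- Move the stack `a` to the stack `b`, whereby it is reversed. -/
def move (a b : R) : Prog R :=
  popLoop a Option.isSome fun o => o.elim skip (push b)

lemma move_does {a b : R} (hab : a ≠ b) (S : R → List Bool) :
    Does (move a b) S (Function.update (Function.update S a []) b ((S a).reverse ++ S b))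
      (2 * (S a).length + 2) := by
  generalize hl : S a = l
  induction l generalizing S with
  | nil =>
    refine popLoop_exit (T := 1) none (by simp [hl]) rfl ?_
    have : Function.update (Function.update S a []) b (([] : List Bool).reverse ++ S b) =
        Function.update S a (S a).tail := by
      funext j
      by_cases hj : j = b
      · subst hj; simp [hab.symm]
      · simp [hj, hl]
    rw [this]
    exact skip_does _
  | cons c l ih =>
    have h := ih (Function.update (Function.update S a l) b (c :: S b)) (by simp [hab])
    refine (popLoop_next (some c) (by simp [hl]) rfl (T₁ := 1)
      (S₁ := Function.update (Function.update S a l) b (c :: S b)) ?_ ?_).mono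
        (T := 1 + 1 + (2 * l.length + 2)) (by simp; omega)
    · have := push_does b c (Function.update S a l)
      rw [Function.update_of_ne hab.symm] at this
      simpa [hl] using this
    · have e : Function.update (Function.update S a []) b ((c :: l).reverse ++ S b) =
        Function.update (Function.update (Function.update (Function.update S a l) b (c :: S b)) a
          []) b (l.reverse ++ (Function.update (Function.update S a l) b (c :: S b)) b) := by
        funext j
        by_cases hj : j = b
        · subst hj; simp
        · by_cases hj' : j = a
          · subst hj'; simp [hab]
          · simp [hj, hj']
      rw [e]
      exact h

/-- Empty the stack `a`. -/
def clear (a : R) : Prog R := popLoop a Option.isSome fun _ => skip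

lemma clear_does (a : R) (S : R → List Bool) :
    Does (clear a) S (Function.update S a []) (2 * (S a).length + 2) := by
  generalize hl : S a = l
  induction l generalizing S with
  | nil =>
    refine popLoop_exit (T := 1) none (by simp [hl]) rfl ?_
    rw [hl]
    exact skip_does _
  | cons c l ih =>
    have h := ih (Function.update S a l) (by simp)
    rw [Function.update_idem] at h
    refine (popLoop_next (some c) (by simp [hl]) rfl (T₁ := 1) ?_ h).mono
      (by simp; omega)
    rw [hl]
    exact skip_does _

end Prog

/-! ### Machines with additional stacks of bits -/

section Extend

variable {K R : Type} [DecidableEq K] [DecidableEq R] {Γ : K → Type} {Λ σ : Type}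

/-- The stacks of a machine together with additional stacks of bits. -/
abbrev ExtΓ (Γ : K → Type) (R : Type) : K ⊕ R → Type
  | .inl k => Γ k
  | .inr _ => Bool

/-- The contents of two families of stacks. -/
def joinStk (A : ∀ k, List (Γ k)) (B : R → List Bool) : ∀ k, List (ExtΓ Γ R k)
  | .inl k => A k
  | .inr k => B k

lemma update_joinStk_inl (A : ∀ k, List (Γ k)) (B : R → List Bool) (k : K) (x : List (Γ k)) :
    Function.update (β := fun k => List (ExtΓ Γ R k)) (joinStk A B) (Sum.inl k) x =
      joinStk (Function.update A k x) B := by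
  funext j
  rcases j with j | j
  · by_cases h : j = k
    · subst h
      exact (Function.update_self _ _ _).trans (Function.update_self j x A).symm
    · have e : Function.update A k x j = A j := Function.update_of_ne h _ _
      exact (Function.update_of_ne (by simpa using h) _ _).trans e.symm
  · exact Function.update_of_ne (by simp) _ _

lemma update_joinStk_inr (A : ∀ k, List (Γ k)) (B : R → List Bool) (k : R) (x : List Bool) :
    Function.update (β := fun k => List (ExtΓ Γ R k)) (joinStk A B) (Sum.inr k) x =
      joinStk A (Function.update B k x) := by
  funext j
  rcases j with j | j
  · exact Function.update_of_ne (by simp) _ _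
  · by_cases h : j = k
    · subst h
      exact (Function.update_self _ _ _).trans (Function.update_self j x B).symm
    · have e : Function.update B k x j = B j := Function.update_of_ne h _ _
      exact (Function.update_of_ne (by simpa using h) _ _).trans e.symm

/-- A statement of a machine, for the machine with additional stacks. -/
def extL (R : Type) : TM2.Stmt Γ Λ σ → TM2.Stmt (ExtΓ Γ R) Λ (σ × Option Bool)
  | .push k a q => .push (Sum.inl k) (fun v => a v.1) (extL R q)
  | .peek k a q => .peek (Sum.inl k) (fun v o => (a v.1 o, v.2)) (extL R q)
  | .pop k a q => .pop (Sum.inl k) (fun v o => (a v.1 o, v.2)) (extL R q)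
  | .load a q => .load (fun v => (a v.1, v.2)) (extL R q)
  | .branch p q₁ q₂ => .branch (fun v => p v.1) (extL R q₁) (extL R q₂)
  | .goto g => .goto fun v => g v.1
  | .halt => .halt

lemma stepAux_extL (q : TM2.Stmt Γ Λ σ) (v : σ) (w : Option Bool) (A : ∀ k, List (Γ k))
    (B : R → List Bool) :
    TM2.stepAux (extL R q) (v, w) (joinStk A B) =
      ⟨(TM2.stepAux q v A).l, ((TM2.stepAux q v A).var, w),
        joinStk (TM2.stepAux q v A).stk B⟩ := by
  induction q generalizing v A with
  | push k a q ih =>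
    exact (congrArg (TM2.stepAux _ _) (update_joinStk_inl _ _ _ _)).trans (ih _ _)
  | peek k a q ih => exact ih _ _
  | pop k a q ih =>
    exact (congrArg (TM2.stepAux _ _) (update_joinStk_inl _ _ _ _)).trans (ih _ _)
  | load a q ih => exact ih _ _
  | branch p q₁ q₂ ih₁ ih₂ =>
    simp only [extL, TM2.stepAux]
    cases p v
    · exact ih₂ _ _
    · exact ih₁ _ _
  | goto g => rfl
  | halt => rfl

/-- A statement of a program for stacks of bits, as a statement for the additional stacks. -/
def extR (Γ : K → Type) (σ : Type) :
    TM2.Stmt (fun _ : R => Bool) Λ (Option Bool) → TM2.Stmt (ExtΓ Γ R) Λ (σ × Option Bool)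
  | .push k a q => .push (Sum.inr k) (fun v => a v.2) (extR Γ σ q)
  | .peek k a q => .peek (Sum.inr k) (fun v o => (v.1, a v.2 o)) (extR Γ σ q)
  | .pop k a q => .pop (Sum.inr k) (fun v o => (v.1, a v.2 o)) (extR Γ σ q)
  | .load a q => .load (fun v => (v.1, a v.2)) (extR Γ σ q)
  | .branch p q₁ q₂ => .branch (fun v => p v.2) (extR Γ σ q₁) (extR Γ σ q₂)
  | .goto g => .goto fun v => g v.2
  | .halt => .halt

lemma stepAux_extR (q : TM2.Stmt (fun _ : R => Bool) Λ (Option Bool)) (v : σ) (w : Option Bool)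
    (A : ∀ k, List (Γ k)) (B : R → List Bool) :
    TM2.stepAux (extR Γ σ q) (v, w) (joinStk A B) =
      ⟨(TM2.stepAux q w B).l, (v, (TM2.stepAux q w B).var),
        joinStk A (TM2.stepAux q w B).stk⟩ := by
  induction q generalizing w B with
  | push k a q ih =>
    exact (congrArg (TM2.stepAux _ _) (update_joinStk_inr _ _ _ _)).trans (ih _ _)
  | peek k a q ih => exact ih _ _
  | pop k a q ih =>
    exact (congrArg (TM2.stepAux _ _) (update_joinStk_inr _ _ _ _)).trans (ih _ _)
  | load a q ih => exact ih _ _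
  | branch p q₁ q₂ ih₁ ih₂ =>
    simp only [extR, TM2.stepAux]
    cases p w
    · exact ih₂ _ _
    · exact ih₁ _ _
  | goto g => rfl
  | halt => rfl

/-- A program for the additional stacks. -/
def Prog.ext (Γ : K → Type) (σ : Type) (F : Prog R) : Frag (ExtΓ Γ R) (σ × Option Bool) :=
  ⟨F.Λ, F.fin, F.entry, fun l => extR Γ σ (F.code l)⟩

lemma Prog.Does.ext {F : Prog R} {S S' : R → List Bool} {T : ℕ} (h : F.Does S S' T)
    (A : ∀ k, List (Γ k)) (v : σ) (w : Option Bool) :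
    ∃ w', (F.ext Γ σ).Runs (v, w) (joinStk A S) (v, w') (joinStk A S') T := by
  obtain ⟨w', t, ht, h⟩ := h w
  exact ⟨w', t, ht, h.simulate (m' := (F.ext Γ σ).code)
    (fun c => ⟨c.l, (v, c.var), joinStk A c.stk⟩)
    fun l w S => Steps.single (stepAux_extR _ _ _ _ _)⟩

end Extend

/-- A machine as a fragment of a program with additional stacks. -/
def callFrag (tm : FinTM2) (R : Type) : Frag (ExtΓ tm.Γ R) (tm.σ × Option Bool) :=
  ⟨tm.Λ, tm.ΛFin, tm.main, fun l => extL R (tm.m l)⟩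

/-- `haltList` has the initial value of the variable and all stacks empty except for the output.
Hence nothing is left to clean up after the call, and the additional stacks are untouched. -/
lemma callFrag_runs {R : Type} [DecidableEq R] (tm : FinTM2) {s : List (tm.Γ tm.k₀)}
    {s' : List (tm.Γ tm.k₁)} {T : ℕ}
    (h : TM2OutputsInTime tm s (some s') T) (B : R → List Bool) (w : Option Bool) :
    (callFrag tm R).Runs (tm.initialState, w) (joinStk (initList tm s).stk B)
      (tm.initialState, w) (joinStk (haltList tm s').stk B) T := by
  have h1 : Steps tm.m h.steps (initList tm s) (haltList tm s') :=
    Steps.of_iterate h.evals_in_steps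
  exact ⟨h.steps, h.steps_le_m, h1.simulate (m' := (callFrag tm R).code)
    (fun c => ⟨c.l, (c.var, w), joinStk c.stk B⟩)
    fun l v S => Steps.single (stepAux_extL _ _ _ _ _)⟩

/-! ### Input and output of machines -/

lemma initList_stk (tm : FinTM2) (s : List (tm.Γ tm.k₀)) :
    (initList tm s).stk = Function.update (fun _ => []) tm.k₀ s := by
  funext k
  by_cases h : k = tm.k₀
  · subst h; simp [initList]
  · simp [initList, h]

lemma haltList_stk (tm : FinTM2) (s : List (tm.Γ tm.k₁)) :
    (haltList tm s).stk = Function.update (fun _ => []) tm.k₁ s := by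
  funext k
  by_cases h : k = tm.k₁
  · subst h; simp [haltList]
  · simp [haltList, h]

/-- A bound for the number of symbols that a statement puts on the stacks. -/
def pushes {K : Type} {Γ : K → Type} {Λ σ : Type} : TM2.Stmt Γ Λ σ → ℕ
  | .push _ _ q => pushes q + 1
  | .peek _ _ q => pushes q
  | .pop _ _ q => pushes q
  | .load _ q => pushes q
  | .branch _ q₁ q₂ => pushes q₁ + pushes q₂
  | .goto _ => 0
  | .halt => 0

lemma length_stepAux_le {K : Type} [DecidableEq K] {Γ : K → Type} {Λ σ : Type}
    (q : TM2.Stmt Γ Λ σ) (v : σ) (S : ∀ k, List (Γ k)) (k : K) :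
    ((TM2.stepAux q v S).stk k).length ≤ (S k).length + pushes q := by
  induction q generalizing v S with
  | push k' a q ih =>
    refine (ih _ _).trans ?_
    by_cases h : k = k'
    · subst h; simp [pushes]; omega
    · simp [pushes, Function.update_of_ne h]
  | peek k' a q ih => exact ih _ _
  | pop k' a q ih =>
    refine (ih _ _).trans ?_
    by_cases h : k = k'
    · subst h; simp [pushes]
    · simp [pushes, Function.update_of_ne h]
  | load a q ih => exact ih _ _
  | branch p q₁ q₂ ih₁ ih₂ =>
    simp only [TM2.stepAux, pushes]
    cases p v
    · exact (ih₂ _ _).trans (by omega)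
    · exact (ih₁ _ _).trans (by omega)
  | goto g => simp [TM2.stepAux, pushes]
  | halt => simp [TM2.stepAux, pushes]

lemma Steps.length_le {K : Type} [DecidableEq K] {Γ : K → Type} {Λ σ : Type}
    {m : Λ → TM2.Stmt Γ Λ σ} {C : ℕ} (hC : ∀ l, pushes (m l) ≤ C) {t : ℕ}
    {c d : TM2.Cfg Γ Λ σ} (h : Steps m t c d) (k : K) :
    (d.stk k).length ≤ (c.stk k).length + C * t := by
  induction h with
  | refl => simp
  | @head t l v S d _ ih =>
    refine ih.trans ?_
    have := length_stepAux_le (m l) v S k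
    have := hC l
    rw [Nat.mul_succ]
    simp only
    omega

/-- The length of the output of a polynomial-time machine is polynomially bounded. -/
lemma exists_length_le {β : Type} {eb : β → List Bool} {f : List Bool → β}
    (h : TM2ComputableInPolyTime (id : List Bool → List Bool) eb f) :
    ∃ P : Polynomial ℕ, ∀ x, (eb (f x)).length ≤ P.eval x.length := by
  have := h.tm.ΛFin
  -- Each step executes one statement and lengthens a stack by at most the number of its pushes,
  -- bounded by the sum over all labels. The summand `X` is needed because the output stack may also
  -- be the input stack.
  refine ⟨Polynomial.X + Polynomial.C (∑ l, pushes (h.tm.m l)) * h.time, fun x => ?_⟩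
  have h0 := h.outputsFun x
  have h1 := Steps.length_le (C := ∑ l, pushes (h.tm.m l))
    (fun l => Finset.single_le_sum (f := fun l => pushes (h.tm.m l)) (fun _ _ => Nat.zero_le _)
      (Finset.mem_univ l))
    (Steps.of_iterate h0.evals_in_steps : Steps h.tm.m h0.steps (initList h.tm _)
      (haltList h.tm _)) h.tm.k₁
  have h2 : ((initList h.tm (List.map h.inputAlphabet.invFun (id x))).stk h.tm.k₁).length
      ≤ x.length := by
    rw [initList_stk]
    generalize h.tm.k₁ = k
    by_cases hk : k = h.tm.k₀
    · subst hk; simp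
    · simp [hk]
  rw [haltList_stk, Function.update_self, List.length_map] at h1
  simp only [Polynomial.eval_add, Polynomial.eval_X, Polynomial.eval_mul, Polynomial.eval_C]
  exact h1.trans (Nat.add_le_add h2 (Nat.mul_le_mul_left _ h0.steps_le_m))

/-- A polynomial-time machine can be combined with a program that is run before it and prepares
its input (in reverse order) on the stack `aux`, and a program that is run after it and finds its
output (in reverse order) on the stack `aux`. -/
theorem polyTime_of_wrap {R : Type} [DecidableEq R] [Fintype R] {β γ : Type}
    {eb : β → List Bool} {eg : γ → List Bool} {f : List Bool → β} {g : List Bool → γ}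
    (h : TM2ComputableInPolyTime (id : List Bool → List Bool) eb f)
    (inp aux out : R) (pre post : Prog R) (B : List Bool → R → List Bool) (T₁ T₂ : Polynomial ℕ)
    (hpre : ∀ x, pre.Does (Function.update (fun _ => []) inp x)
      (Function.update (B x) aux x.reverse) (T₁.eval x.length))
    (hpost : ∀ x, post.Does (Function.update (B x) aux (eb (f x)).reverse)
      (Function.update (fun _ => []) out (eg (g x))) (T₂.eval x.length)) :
    Nonempty (TM2ComputableInPolyTime (id : List Bool → List Bool) eg g) := by
  obtain ⟨P, hP⟩ := exists_length_le h
  let tm := h.tm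
  have := tm.kFin
  let A₀ : ∀ k, List (tm.Γ k) := fun _ => []
  -- A transfer reverses the stack, which is why `aux` holds strings in reverse order on both sides
  -- of the call. The default `false` of `getD` is never written, since a push happens only if a
  -- symbol was read.
  let toM : Frag (ExtΓ tm.Γ R) (tm.σ × Option Bool) :=
    Frag.transfer (Sum.inr aux) (Sum.inl tm.k₀) (fun v o => (v.1, o)) (fun v => v.2.isSome)
      fun v => h.inputAlphabet.symm (v.2.getD false)
  let fromM : Frag (ExtΓ tm.Γ R) (tm.σ × Option Bool) :=
    Frag.transfer (Sum.inl tm.k₁) (Sum.inr aux)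
      (fun v o => (v.1, o.map h.outputAlphabet)) (fun v => v.2.isSome)
      fun v => v.2.getD false
  -- The last program leaves an arbitrary bit in the variable, but `haltList` demands the initial
  -- value.
  let reset : Frag (ExtΓ tm.Γ R) (tm.σ × Option Bool) :=
    Frag.single (.load (fun v => (v.1, none)) .halt)
  let F := (pre.ext tm.Γ tm.σ).seq (toM.seq ((callFrag tm R).seq
    (fromM.seq ((post.ext tm.Γ tm.σ).seq reset))))
  have key : ∀ x, F.Runs (tm.initialState, none)
      (joinStk A₀ (Function.update (fun _ => []) inp x)) (tm.initialState, none)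
      (joinStk A₀ (Function.update (fun _ => []) out (eg (g x))))
      (T₁.eval x.length + ((x.length + 1) + (h.time.eval x.length +
        ((P.eval x.length + 1) + (T₂.eval x.length + 1))))) := by
    intro x
    obtain ⟨w₁, r₁⟩ := (hpre x).ext A₀ tm.initialState none
    obtain ⟨w₂, e₂, r₂⟩ := Frag.transfer_runs (k := (Sum.inr aux : tm.K ⊕ R))
      (k' := Sum.inl tm.k₀) (Γ := ExtΓ tm.Γ R) (by simp)
      (r := fun v o => (v.1, o)) (more := fun v => v.2.isSome)
      (w := fun v => h.inputAlphabet.symm (v.2.getD false)) h.inputAlphabet.symm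
      (fun v => v.1 = tm.initialState)
      (fun v o hv => ⟨hv, rfl, fun a ha => by obtain rfl := Option.mem_def.1 ha; rfl⟩)
      (tm.initialState, w₁) rfl (joinStk A₀ (Function.update (B x) aux x.reverse))
    obtain ⟨w₂', w₂⟩ := w₂
    obtain rfl : w₂' = tm.initialState := e₂
    have s₂ : Function.update (β := fun k => List (ExtΓ tm.Γ R k)) (Function.update
        (β := fun k => List (ExtΓ tm.Γ R k))
        (joinStk A₀ (Function.update (B x) aux x.reverse)) (Sum.inr aux) [])
        (Sum.inl tm.k₀) ((((joinStk A₀ (Function.update (B x) aux x.reverse))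
          (Sum.inr aux)).map h.inputAlphabet.symm).reverse ++
          (joinStk A₀ (Function.update (B x) aux x.reverse)) (Sum.inl tm.k₀)) =
        joinStk (initList tm (List.map h.inputAlphabet.invFun (id x))).stk
          (Function.update (B x) aux []) := by
      refine (congrArg (fun S => Function.update (β := fun k => List (ExtΓ tm.Γ R k)) S _ _)
        (update_joinStk_inr _ _ _ _)).trans ?_
      refine (update_joinStk_inl _ _ _ _).trans ?_
      rw [initList_stk, Function.update_idem]
      congr 2
      change ((Function.update (B x) aux x.reverse aux).map _).reverse ++ [] = _
      simp
    have l₂ : ((joinStk A₀ (Function.update (B x) aux x.reverse)) (Sum.inr aux)).length =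
        x.length := by
      change (Function.update (B x) aux x.reverse aux).length = _
      simp
    rw [s₂, l₂] at r₂
    have r₃ := callFrag_runs tm (h.outputsFun x) (Function.update (B x) aux []) w₂
    obtain ⟨w₄, e₄, r₄⟩ := Frag.transfer_runs (k := (Sum.inl tm.k₁ : tm.K ⊕ R))
      (k' := Sum.inr aux) (Γ := ExtΓ tm.Γ R) (by simp)
      (r := fun v o => (v.1, o.map h.outputAlphabet)) (more := fun v => v.2.isSome)
      (w := fun v => v.2.getD false) h.outputAlphabet
      (fun v => v.1 = tm.initialState)
      (fun v o hv => ⟨hv, by simp, fun a ha => by obtain rfl := Option.mem_def.1 ha; rfl⟩)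
      (tm.initialState, w₂) rfl (joinStk (haltList tm (List.map h.outputAlphabet.invFun
        (eb (f x)))).stk (Function.update (B x) aux []))
    obtain ⟨w₄', w₄⟩ := w₄
    obtain rfl : w₄' = tm.initialState := e₄
    have j₄ : joinStk (haltList tm (List.map h.outputAlphabet.invFun
        (eb (f x)))).stk (Function.update (B x) aux []) (Sum.inl tm.k₁) =
        List.map h.outputAlphabet.invFun (eb (f x)) := by
      change (haltList tm _).stk tm.k₁ = _
      rw [haltList_stk, Function.update_self]
    have s₄ : Function.update (β := fun k => List (ExtΓ tm.Γ R k)) (Function.update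
        (β := fun k => List (ExtΓ tm.Γ R k))
        (joinStk (haltList tm (List.map h.outputAlphabet.invFun (eb (f x)))).stk
          (Function.update (B x) aux [])) (Sum.inl tm.k₁) [])
        (Sum.inr aux) (((List.map h.outputAlphabet.invFun (eb (f x))).map
          h.outputAlphabet).reverse ++
          (joinStk (haltList tm (List.map h.outputAlphabet.invFun (eb (f x)))).stk
          (Function.update (B x) aux [])) (Sum.inr aux)) =
        joinStk A₀ (Function.update (B x) aux (eb (f x)).reverse) := by
      refine (congrArg (fun S => Function.update (β := fun k => List (ExtΓ tm.Γ R k)) S _ _)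
        (update_joinStk_inl _ _ _ _)).trans ?_
      refine (update_joinStk_inr _ _ _ _).trans ?_
      rw [haltList_stk, Function.update_idem, Function.update_idem]
      congr 1
      · exact Function.update_eq_self _ _
      · congr 1
        change _ ++ Function.update (B x) aux [] aux = _
        simp [Function.comp_def]
    have l₄ : (joinStk (haltList tm (List.map h.outputAlphabet.invFun
        (eb (f x)))).stk (Function.update (B x) aux []) (Sum.inl tm.k₁)).length =
        (eb (f x)).length := by
      rw [j₄]; exact List.length_map _
    rw [l₄] at r₄
    rw [j₄, s₄] at r₄
    obtain ⟨w₅, r₅⟩ := (hpost x).ext A₀ tm.initialState w₄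
    have r₆ : reset.Runs (tm.initialState, w₅)
        (joinStk A₀ (Function.update (fun _ => []) out (eg (g x)))) (tm.initialState, none)
        (joinStk A₀ (Function.update (fun _ => []) out (eg (g x)))) 1 :=
      ⟨1, le_rfl, Steps.single rfl⟩
    exact r₁.seq (r₂.seq (r₃.seq ((r₄.mono (Nat.add_le_add_right (hP x) 1)).seq (r₅.seq r₆))))
  let tm' : FinTM2 :=
    { K := tm.K ⊕ R
      k₀ := Sum.inr inp
      k₁ := Sum.inr out
      Γ := ExtΓ tm.Γ R
      Λ := F.Λ
      main := F.entry
      ΛFin := F.fin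
      σ := tm.σ × Option Bool
      initialState := (tm.initialState, none)
      σFin := by have := tm.σFin; exact inferInstance
      Γk₀Fin := (inferInstance : Fintype Bool)
      m := F.code }
  have hst : ∀ (k : R) (s : List Bool), Function.update
      (β := fun k => List (ExtΓ tm.Γ R k)) (fun _ => []) (Sum.inr k) s =
      joinStk A₀ (Function.update (fun _ => []) k s) := by
    intro k s
    rw [← update_joinStk_inr]
    congr 1
    funext j
    cases j <;> rfl
  refine ⟨⟨⟨tm', Equiv.refl Bool, Equiv.refl Bool⟩, T₁ + ((Polynomial.X + 1) + (h.time +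
        ((P + 1) + (T₂ + 1)))), fun x => ?_⟩⟩
  have hk : ∃ t ≤ _, _ := key x
  refine ⟨⟨hk.choose, ?_⟩, ?_⟩
  · have e₁ : initList tm' (List.map (Equiv.refl Bool).invFun (id x)) =
        ⟨some F.entry, (tm.initialState, none),
          joinStk A₀ (Function.update (fun _ => []) inp x)⟩ := by
      have := (initList_stk tm' (List.map (Equiv.refl Bool).invFun (id x))).trans
        ((congrArg (fun y => Function.update
      (β := fun k => List (ExtΓ tm.Γ R k)) (fun _ => []) (Sum.inr inp) y)
        (List.map_id x)).trans (hst inp x))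
      rw [← this]
      rfl
    have e₂ : haltList tm' (List.map (Equiv.refl Bool).invFun (eg (g x))) =
        ⟨none, (tm.initialState, none),
          joinStk A₀ (Function.update (fun _ => []) out (eg (g x)))⟩ := by
      have := (haltList_stk tm' (List.map (Equiv.refl Bool).invFun (eg (g x)))).trans
        ((congrArg (fun y => Function.update
      (β := fun k => List (ExtΓ tm.Γ R k)) (fun _ => []) (Sum.inr out) y)
        (List.map_id (eg (g x)))).trans (hst out (eg (g x))))
      rw [← this]
      rfl
    rw [e₁]
    refine hk.choose_spec.2.iterate.trans ?_
    exact congrArg some e₂.symm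
  · refine hk.choose_spec.1.trans (le_of_eq ?_)
    simp

/-! ### The program that transforms the circuits -/

/-- The names of the stacks. -/
inductive Reg (d : ℕ) : Type
  | inp | aux | hdr | out
  | cnt (i : Fin d)
  | tmp (i : Fin d)
  deriving DecidableEq, Fintype

namespace Prog

variable {d : ℕ}

lemma Does.to {R : Type} [DecidableEq R] {F : Prog R} {S S' S'' : R → List Bool} {T T' : ℕ}
    (h : Does F S S' T) (hS : S' = S'') (hT : T ≤ T') : Does F S S'' T' :=
  hS ▸ h.mono hT

/-- The stacks with the given contents, where each of the counters holds `n` in unary. -/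
def regs (n : ℕ) (x y h o : List Bool) : Reg d → List Bool
  | .inp => x
  | .aux => y
  | .hdr => h
  | .out => o
  | .cnt _ => List.replicate n true
  | .tmp _ => []

section

variable (n : ℕ) (x y h o z : List Bool)

@[simp] lemma update_regs_inp :
    Function.update (regs n x y h o : Reg d → _) .inp z = regs n z y h o := by
  funext k; cases k <;> simp [regs]

@[simp] lemma update_regs_aux :
    Function.update (regs n x y h o : Reg d → _) .aux z = regs n x z h o := by
  funext k; cases k <;> simp [regs]

@[simp] lemma update_regs_hdr :
    Function.update (regs n x y h o : Reg d → _) .hdr z = regs n x y z o := by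
  funext k; cases k <;> simp [regs]

@[simp] lemma update_regs_out :
    Function.update (regs n x y h o : Reg d → _) .out z = regs n x y h z := by
  funext k; cases k <;> simp [regs]

@[simp] lemma regs_inp : (regs n x y h o : Reg d → _) .inp = x := rfl
@[simp] lemma regs_aux : (regs n x y h o : Reg d → _) .aux = y := rfl
@[simp] lemma regs_hdr : (regs n x y h o : Reg d → _) .hdr = h := rfl
@[simp] lemma regs_out : (regs n x y h o : Reg d → _) .out = o := rfl

end

/-! #### Operations on all counters -/

/-- Run `F i` for the indices `i` of a list. -/
def forList (F : Fin d → Prog (Reg d)) (l : List (Fin d)) : Prog (Reg d) :=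
  l.foldr (fun i G => Frag.seq (F i) G) skip

/-- Apply `φ` to the contents of the counters of a list. -/
def mapCnt (l : List (Fin d)) (φ : List Bool → List Bool) (S : Reg d → List Bool) :
    Reg d → List Bool
  | .cnt i => if i ∈ l then φ (S (.cnt i)) else S (.cnt i)
  | k => S k

lemma forList_does {F : Fin d → Prog (Reg d)} {φ : List Bool → List Bool} {N T : ℕ}
    (hF : ∀ i S, (S (.cnt i)).length ≤ N →
      Does (F i) S (Function.update S (.cnt i) (φ (S (.cnt i)))) T)
    (l : List (Fin d)) (hl : l.Nodup) (S : Reg d → List Bool)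
    (hS : ∀ i ∈ l, (S (.cnt i)).length ≤ N) :
    Does (forList F l) S (mapCnt l φ S) (l.length * T + 1) := by
  induction l generalizing S with
  | nil =>
    have : mapCnt [] φ S = S := by funext k; cases k <;> simp [mapCnt]
    rw [this]
    exact (skip_does S).mono (by simp)
  | cons j l ih =>
    obtain ⟨hj, hl⟩ := List.nodup_cons.1 hl
    have h1 := hF j S (hS j (by simp))
    have h2 := ih hl (Function.update S (.cnt j) (φ (S (.cnt j)))) fun i hi => by
      have : i ≠ j := fun h => hj (h ▸ hi)
      rw [Function.update_of_ne (by simpa using this)]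
      exact hS i (by simp [hi])
    have : mapCnt l φ (Function.update S (.cnt j) (φ (S (.cnt j)))) = mapCnt (j :: l) φ S := by
      funext k
      cases k with
      | cnt i =>
        by_cases hij : i = j
        · subst hij; simp [mapCnt, hj]
        · simp [mapCnt, hij]
      | _ => simp [mapCnt]
    rw [this] at h2
    exact (h1.seq h2).mono (by simp; ring_nf; rfl)

/-- Push a bit on each of the counters. -/
def pushAll (d : ℕ) : Prog (Reg d) := forList (fun i => push (.cnt i) true) (List.finRange d)

lemma pushAll_does (n : ℕ) (x y h o : List Bool) :
    Does (pushAll d) (regs n x y h o) (regs (n + 1) x y h o) (d + 1) := by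
  have := forList_does (N := n) (T := 1) (φ := fun l => true :: l)
    (fun i S _ => push_does (.cnt i) true S) (List.finRange d) (List.nodup_finRange d)
    (regs n x y h o) (by simp [regs])
  have e : mapCnt (List.finRange d) (fun l => true :: l) (regs n x y h o) =
      regs (n + 1) x y h o := by
    funext k; cases k <;> simp [mapCnt, regs, List.replicate_succ]
  rw [e] at this
  exact this.mono (by simp)

/-- Empty the counters. -/
def clearAll (d : ℕ) : Prog (Reg d) := forList (fun i => clear (.cnt i)) (List.finRange d)

lemma clearAll_does (n : ℕ) (x y h o : List Bool) :
    Does (clearAll d) (regs n x y h o) (regs 0 x y h o) (d * (2 * n + 2) + 1) := by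
  have := forList_does (N := n) (T := 2 * n + 2) (φ := fun _ => [])
    (fun i S hS => (clear_does (.cnt i) S).mono (by omega)) (List.finRange d)
    (List.nodup_finRange d) (regs n x y h o) (by simp [regs])
  have e : mapCnt (List.finRange d) (fun _ => []) (regs n x y h o) = regs 0 x y h o := by
    funext k; cases k <;> simp [mapCnt, regs]
  rw [e] at this
  exact this.mono (by simp)

/-- Move the input to the stack `aux`, and store its length on each of the counters. -/
def readInput (d : ℕ) : Prog (Reg d) :=
  popLoop .inp Option.isSome fun o => o.elim skip fun b => Frag.seq (push .aux b) (pushAll d)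

/-- Each bit costs `d + 3` steps: its removal, its push on `aux`, and `d + 1` for the counters. -/
lemma readInput_does (n : ℕ) (x y h o : List Bool) :
    Does (readInput d) (regs n x y h o) (regs (n + x.length) [] (x.reverse ++ y) h o)
      ((d + 3) * x.length + 2) := by
  induction x generalizing n y with
  | nil => exact popLoop_exit (T := 1) none rfl rfl (by simpa using skip_does _)
  | cons b x ih =>
    have h1 := (push_does .aux b (regs n x y h o : Reg d → _)).seq
      (by simpa using pushAll_does n x (b :: y) h o)
    have h2 := ih (n + 1) (b :: y)
    have := popLoop_next (k := Reg.inp) (cont := Option.isSome)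
      (F := fun o => o.elim skip fun b => Frag.seq (push .aux b) (pushAll d))
      (S := regs n (b :: x) y h o) (some b) rfl rfl (by simpa using h1) h2
    exact this.to (by simp [Nat.add_assoc, Nat.add_comm 1]) (le_of_eq (by simp; ring))

/-! #### Unary numbers -/

/-- `p` puts `c` marks on the output stack in time `T`, provided that the counters of the
list `l` hold `n`. -/
def Marks (n : ℕ) (p : Prog (Reg d)) (l : List (Fin d)) (c T : ℕ) : Prop :=
  ∀ S : Reg d → List Bool,
    (∀ i ∈ l, S (.cnt i) = List.replicate n true ∧ S (.tmp i) = []) →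
    Does p S (Function.update S .out (List.replicate c true ++ S .out)) T

lemma Marks.seq {n : ℕ} {p q : Prog (Reg d)} {l : List (Fin d)} {c c' T T' : ℕ}
    (hp : Marks n p l c T) (hq : Marks n q l c' T') :
    Marks n (Frag.seq p q) l (c + c') (T + T') := by
  intro S hS
  have h1 := hp S hS
  have h2 := hq (Function.update S .out (List.replicate c true ++ S .out))
    (fun i hi => by simpa using hS i hi)
  simp only [Function.update_self, Function.update_idem] at h2
  rw [← List.append_assoc, ← List.replicate_add, Nat.add_comm c'] at h2
  exact h1.seq h2

/-- Run `p` as often as the counter `i` tells. -/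
def repeatCnt (i : Fin d) (p : Prog (Reg d)) : Prog (Reg d) :=
  Frag.seq (popLoop (.cnt i) Option.isSome fun o =>
    o.elim skip fun _ => Frag.seq p (push (.tmp i) true)) (move (.tmp i) (.cnt i))

/-- The counter is consumed by the loop while `tmp i` collects what was removed, and the final
`move` restores it. In between the counter `i` does not hold `n`, so `p` must rely on other counters
only; hence `i ∉ l`, and nested loops need distinct counters. -/
lemma Marks.repeatCnt {n : ℕ} {p : Prog (Reg d)} {i : Fin d} {l : List (Fin d)} (hi : i ∉ l)
    {c T : ℕ} (hp : Marks n p l c T) :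
    Marks n (repeatCnt i p) (i :: l) (n * c) (n * (T + 2) + 2 + (2 * n + 2)) := by
  have loop : ∀ (a : ℕ) (S : Reg d → List Bool), S (.cnt i) = List.replicate a true →
      (∀ j ∈ l, S (.cnt j) = List.replicate n true ∧ S (.tmp j) = []) →
      Does (popLoop (.cnt i) Option.isSome fun o =>
        o.elim skip fun _ => Frag.seq p (push (.tmp i) true)) S
        (Function.update (Function.update (Function.update S (.cnt i) []) (.tmp i)
          (List.replicate a true ++ S (.tmp i))) .out (List.replicate (a * c) true ++ S .out))
        (a * (T + 2) + 2) := by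
    intro a
    induction a with
    | zero =>
      intro S h1 h2
      refine (popLoop_exit (k := Reg.cnt i) (cont := Option.isSome) (S := S) (T := 1) none
        (by simp [h1]) rfl ?_).mono (by simp)
      refine (skip_does _).to ?_ le_rfl
      funext k
      cases k with
      | tmp j => by_cases hj : j = i <;> simp [hj, h1]
      | _ => simp [h1]
    | succ a ih =>
      intro S h1 h2
      have hne : ∀ j ∈ l, j ≠ i := fun j hj h => hi (h ▸ hj)
      have s1 := hp (Function.update S (.cnt i) (List.replicate a true)) fun j hj => by
        simpa [hne j hj] using h2 j hj
      have s2 := s1.seq (push_does (.tmp i) true _)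
      have s3 := ih (Function.update (Function.update (Function.update S (.cnt i)
        (List.replicate a true)) .out (List.replicate c true ++ S .out)) (.tmp i)
        (true :: S (.tmp i))) (by simp) fun j hj => by simpa [hne j hj] using h2 j hj
      have := popLoop_next (k := Reg.cnt i) (cont := Option.isSome)
        (F := fun o => o.elim skip fun _ => Frag.seq p (push (.tmp i) true))
        (S := S) (some true) (by simp [h1, List.replicate_succ]) rfl
        (by simpa [h1, List.replicate_succ] using s2) s3
      refine this.to ?_ (by ring_nf; rfl)
      funext k
      cases k with
      | out =>
        simp only [Function.update_self, ne_eq, reduceCtorEq, not_false_eq_true,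
          Function.update_of_ne, ← List.append_assoc, ← List.replicate_add]
        simp [Nat.succ_mul]
      | tmp j =>
        by_cases hj : j = i
        · subst hj
          simp [List.replicate_succ']
        · simp [hj]
      | cnt j => by_cases hj : j = i <;> simp [hj]
      | _ => simp
  intro S hS
  have h1 := loop n S (hS i (by simp)).1 fun j hj => hS j (by simp [hj])
  have h2 := h1.seq (move_does (a := Reg.tmp i) (b := Reg.cnt i) (by simp) _)
  refine h2.to ?_ (by simp [(hS i (by simp)).2])
  funext k
  cases k with
  | cnt j =>
    by_cases hj : j = i
    · subst hj; simp [(hS j (by simp)).1, (hS j (by simp)).2]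
    · simp [hj]
  | tmp j =>
    by_cases hj : j = i
    · subst hj; simp [(hS j (by simp)).2]
    · simp [hj]
  | _ => simp

/-- Put `(n + 2) ^ l.length` marks on the output stack, where the counters hold `n`. -/
def power (l : List (Fin d)) : Prog (Reg d) :=
  l.foldr (fun i p => Frag.seq (repeatCnt i p) (Frag.seq p p)) (push .out true)

lemma Marks.cons {n : ℕ} {p : Prog (Reg d)} {l : List (Fin d)} {c T : ℕ} (i : Fin d)
    (hp : Marks n p l c T) : Marks n p (i :: l) c T :=
  fun S hS => hp S fun j hj => hS j (by simp [hj])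

/-- With `c` marks from the shorter list, a loop over one more counter gives `n * c`, and two
further runs give `(n + 2) * c`. This is where the base `n + 2` comes from. -/
lemma power_marks (l : List (Fin d)) (hl : l.Nodup) :
    ∃ P : Polynomial ℕ, ∀ n, Marks n (power l) l ((n + 2) ^ l.length) (P.eval n) := by
  induction l with
  | nil =>
    refine ⟨1, fun n S _ => ?_⟩
    simpa [power] using push_does .out true S
  | cons i l ih =>
    obtain ⟨hi, hl⟩ := List.nodup_cons.1 hl
    obtain ⟨P, hP⟩ := ih hl
    refine ⟨Polynomial.X * (P + 2) + 2 + (2 * Polynomial.X + 2) + (P + P), fun n => ?_⟩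
    have := ((hP n).repeatCnt hi).seq (((hP n).cons i).seq ((hP n).cons i))
    have e : (n + 2) ^ (i :: l).length =
        n * (n + 2) ^ l.length + ((n + 2) ^ l.length + (n + 2) ^ l.length) := by
      rw [List.length_cons]; ring
    rw [e]
    change Marks n (power (i :: l)) _ _ _ at this
    simpa using this

/-- A text consisting of bits `Sum.inl b` and unary numbers `(n + 2) ^ e`, written
`Sum.inr e`. -/
def textVal (n : ℕ) (w : List (Bool ⊕ ℕ)) : List Bool :=
  w.flatMap (Sum.elim (fun b => [b]) fun e => List.replicate ((n + 2) ^ e) true)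

/-- Put a text on the output stack. -/
def emitText (d : ℕ) (w : List (Bool ⊕ ℕ)) : Prog (Reg d) :=
  w.foldr (fun s p => Frag.seq p
    (s.elim (fun b => push .out b) fun e => power ((List.finRange d).take e))) skip

/-- The text is written from its end, so that its first symbol lands on top. A power with exponent
`e` uses the first `e` counters; this is why `e ≤ d` is required. -/
lemma emitText_does (w : List (Bool ⊕ ℕ)) (hw : ∀ e, Sum.inr e ∈ w → e ≤ d) :
    ∃ P : Polynomial ℕ, ∀ n x y h o, Does (emitText d w) (regs n x y h o)
      (regs n x y h (textVal n w ++ o)) (P.eval n) := by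
  induction w with
  | nil => exact ⟨1, fun n x y h o => (skip_does _).to (by simp [textVal]) (by simp)⟩
  | cons s w ih =>
    obtain ⟨P, hP⟩ := ih fun e he => hw e (by simp [he])
    rcases s with b | e
    · refine ⟨P + 1, fun n x y h o => ?_⟩
      have := (hP n x y h o).seq (push_does .out b _)
      exact this.to (by simp [textVal]) (by simp)
    · obtain ⟨Q, hQ⟩ := power_marks ((List.finRange d).take e)
        ((List.nodup_finRange d).sublist (List.take_sublist _ _))
      refine ⟨P + Q, fun n x y h o => ?_⟩
      have := (hP n x y h o).seq (hQ n _ (by simp [regs]))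
      have he : e ≤ d := hw e (by simp)
      exact this.to (by simp [textVal, he]) (by simp)

end Prog

lemma eval_mono_nat (P : Polynomial ℕ) {a b : ℕ} (h : a ≤ b) : P.eval a ≤ P.eval b := by
  rw [Polynomial.eval_eq_sum_range, Polynomial.eval_eq_sum_range]
  gcongr

/-! ### Translating the code of a circuit into that of its controlled version -/

/-- The position, in the larger register, of a qubit of the original circuit;
position `1` is left free. -/
def shiftWire (i : ℕ) : ℕ := if i = 0 then 0 else i + 1

/-- The code of the controlled gate, where `wH`, `wT`, `wC` are the codes of the matrices. -/
def StdGate.ctrlCode (wH wT wC : List Bool) {m : ℕ} : StdGate m → List Bool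
  | .h i => codeNat 2 ++ codeNat 1 ++ (codeNat (shiftWire i) ++ wH)
  | .t i => codeNat 2 ++ codeNat 1 ++ (codeNat (shiftWire i) ++ wT)
  | .cx a b _ => codeNat 3 ++ codeNat 1 ++ (codeNat (shiftWire a) ++
      (codeNat (shiftWire b) ++ wC))

namespace Prog

variable {d : ℕ}

lemma push_aux_does (b : Bool) (n : ℕ) (x y h o : List Bool) :
    Does (push .aux b : Prog (Reg d)) (regs n x y h o) (regs n x (b :: y) h o) 1 := by
  simpa using push_does Reg.aux b (regs n x y h o : Reg d → _)

lemma push_hdr_does (b : Bool) (n : ℕ) (x y h o : List Bool) :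
    Does (push .hdr b : Prog (Reg d)) (regs n x y h o) (regs n x y (b :: h) o) 1 := by
  simpa using push_does Reg.hdr b (regs n x y h o : Reg d → _)

section

variable {cont : Option Bool → Bool} {F : Option Bool → Prog (Reg d)} {n T T₁ T₂ : ℕ} {b : Bool}
  {x y h o : List Bool} {S₁ S' : Reg d → List Bool}

lemma popInp_exit (hc : cont (some b) = false) (hF : Does (F (some b)) (regs n x y h o) S' T) :
    Does (popLoop .inp cont F) (regs n (b :: x) y h o) S' (T + 1) :=
  popLoop_exit (some b) rfl hc (by simpa using hF)

lemma popInp_next (hc : cont (some b) = true) (hF : Does (F (some b)) (regs n x y h o) S₁ T₁)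
    (hl : Does (popLoop .inp cont F) S₁ S' T₂) :
    Does (popLoop .inp cont F) (regs n (b :: x) y h o) S' (T₁ + 1 + T₂) :=
  popLoop_next (some b) rfl hc (by simpa using hF) hl

end

lemma replicate_append_cons (i : ℕ) (b : Bool) (l : List Bool) :
    List.replicate i b ++ b :: l = b :: (List.replicate i b ++ l) := by
  rw [← List.singleton_append, ← List.append_assoc, ← List.replicate_succ',
    List.replicate_succ, List.cons_append]

/-- Append a string to the (reversed) string on the stack `aux`. -/
def append (d : ℕ) (w : List Bool) : Prog (Reg d) := emit .aux w.reverse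

lemma append_does (w : List Bool) (n : ℕ) (x y h o : List Bool) :
    Does (append d w) (regs n x y h o) (regs n x (w.reverse ++ y) h o) (w.length + 1) := by
  simpa [append] using emit_does Reg.aux w.reverse (regs n x y h o : Reg d → _)

/-- Copy the code of a number. -/
def copyNat (d : ℕ) : Prog (Reg d) :=
  popLoop .inp (fun o => o == some true) fun o => push .aux (o == some true)

lemma copyNat_does (i n : ℕ) (x y h o : List Bool) :
    Does (copyNat d) (regs n (codeNat i ++ x) y h o) (regs n x ((codeNat i).reverse ++ y) h o)
      (2 * i + 2) := by
  induction i generalizing y with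
  | zero => exact popInp_exit rfl (push_aux_does false n x y h o)
  | succ i ih =>
    refine (popInp_next rfl (push_aux_does true n (codeNat i ++ x) y h o)
      (ih (true :: y))).to ?_ (by omega)
    simp [codeNat, List.replicate_succ, replicate_append_cons]

/-- Copy the code of a number `i`, which is replaced by `shiftWire i`. -/
def copyShift (d : ℕ) : Prog (Reg d) :=
  popLoop .inp (fun _ => false) fun
    | some true => Frag.seq (push .aux true) (Frag.seq (push .aux true) (copyNat d))
    | _ => push .aux false

/-- The first bit decides: `false` means that the number is `0`, which stays; otherwise the mark
just read is written together with an additional one, and the rest is copied. -/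
lemma copyShift_does (i n : ℕ) (x y h o : List Bool) :
    Does (copyShift d) (regs n (codeNat i ++ x) y h o)
      (regs n x ((codeNat (shiftWire i)).reverse ++ y) h o) (2 * i + 5) := by
  rcases i with _ | i
  · exact Does.mono (popInp_exit rfl (push_aux_does false n x y h o)) (by omega)
  · have := (push_aux_does true n (codeNat i ++ x) y h o).seq
      ((push_aux_does (d := d) true n _ _ h o).seq (copyNat_does i n x _ h o))
    refine Does.to (popInp_exit rfl this) ?_ (by omega)
    simp [shiftWire, codeNat, List.replicate_succ, replicate_append_cons]

/-- Translate the code of a gate on one qubit, after its type has been read. -/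
def gate1 (d : ℕ) (w : List Bool) : Prog (Reg d) :=
  Frag.seq (append d (codeNat 2 ++ codeNat 1)) (Frag.seq (copyShift d) (append d w))

lemma gate1_does (w : List Bool) (i n : ℕ) (x y h o : List Bool) :
    Does (gate1 d w) (regs n (codeNat i ++ x) y h o) (regs n x
      ((codeNat 2 ++ codeNat 1 ++ (codeNat (shiftWire i) ++ w)).reverse ++ y) h o)
      (2 * i + w.length + 12) := by
  have := (append_does (codeNat 2 ++ codeNat 1) n (codeNat i ++ x) y h o).seq
    ((copyShift_does (d := d) i n x _ h o).seq (append_does w n x _ h o))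
  exact this.to (by simp) (by simp [codeNat]; omega)

/-- Translate the code of a gate on two qubits, after its type has been read. -/
def gate2 (d : ℕ) (w : List Bool) : Prog (Reg d) :=
  Frag.seq (append d (codeNat 3 ++ codeNat 1))
    (Frag.seq (copyShift d) (Frag.seq (copyShift d) (append d w)))

lemma gate2_does (w : List Bool) (i j n : ℕ) (x y h o : List Bool) :
    Does (gate2 d w) (regs n (codeNat i ++ (codeNat j ++ x)) y h o) (regs n x
      ((codeNat 3 ++ codeNat 1 ++ (codeNat (shiftWire i) ++ (codeNat (shiftWire j) ++
        w))).reverse ++ y) h o)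
      (2 * i + 2 * j + w.length + 18) := by
  have := (append_does (codeNat 3 ++ codeNat 1) n (codeNat i ++ (codeNat j ++ x)) y h o).seq
    ((copyShift_does (d := d) i n (codeNat j ++ x) _ h o).seq
      ((copyShift_does (d := d) j n x _ h o).seq (append_does w n x _ h o)))
  exact this.to (by simp) (by simp [codeNat]; omega)

/-- Translate the code of a gate. -/
def gate (d : ℕ) (wH wT wC : List Bool) : Prog (Reg d) :=
  popLoop .inp (fun _ => false) fun
    | some true => popLoop .inp (fun _ => false) fun
      | some true => popLoop .inp (fun _ => false) fun _ => gate2 d wC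
      | _ => gate1 d wT
    | _ => gate1 d wH

/-- The types `0`, `1`, `2` are coded in unary, so at most three nested removals identify the
letter. -/
lemma gate_does (wH wT wC : List Bool) {m : ℕ} (g : StdGate m) (n : ℕ) (x y h o : List Bool) :
    Does (gate d wH wT wC) (regs n (g.code ++ x) y h o)
      (regs n x ((g.ctrlCode wH wT wC).reverse ++ y) h o)
      (wH.length + wT.length + wC.length + 30 + 2 * g.code.length) := by
  cases g with
  | h i =>
    have := gate1_does (d := d) wH i n x y h o
    exact Does.mono (popInp_exit rfl this) (by simp [StdGate.code, codeNat]; omega)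
  | t i =>
    have := gate1_does (d := d) wT i n x y h o
    refine Does.mono (popInp_exit rfl (popInp_exit rfl this))
      (by simp [StdGate.code, codeNat]; omega)
  | cx a b ne =>
    have := gate2_does (d := d) wC a b n x y h o
    have e : StdGate.code (.cx a b ne) ++ x =
        true :: true :: false :: (codeNat a ++ (codeNat b ++ x)) := by
      simp [StdGate.code, codeNat, List.replicate_succ]
    rw [e]
    refine Does.mono (popInp_exit rfl (popInp_exit rfl (popInp_exit rfl this)))
        (by simp [StdGate.code, codeNat]; omega)

/-- Translate the codes of the gates up to the end of the circuit. -/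
def gates (d : ℕ) (wH wT wC : List Bool) : Prog (Reg d) :=
  popLoop .inp (fun o => o == some true) fun
    | some true => Frag.seq (push .hdr true) (Frag.seq (push .aux true) (gate d wH wT wC))
    | _ => push .aux false

/-- Besides translating, every gate leaves a mark on `hdr`, on top of the marks for the qubits: the
new register has one idle qubit per gate. -/
lemma gates_does (wH wT wC : List Bool) {m : ℕ} (gs : List (StdGate m)) (n : ℕ)
    (y h o : List Bool) :
    Does (gates d wH wT wC)
      (regs n (gs.flatMap (fun g => true :: g.code) ++ [false]) y h o)
      (regs n [] ((gs.flatMap (fun g => true :: g.ctrlCode wH wT wC) ++ [false]).reverse ++ y)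
        (List.replicate gs.length true ++ h) o)
      ((wH.length + wT.length + wC.length + 35) *
        (gs.flatMap (fun g => true :: g.code) ++ [false]).length) := by
  induction gs generalizing y h with
  | nil => exact Does.mono (popInp_exit rfl (push_aux_does false n [] y h o)) (by simp)
  | cons g gs ih =>
    have h1 := (push_hdr_does (d := d) true n (g.code ++ (gs.flatMap (fun g => true :: g.code) ++
      [false])) y h o).seq ((push_aux_does true n _ _ _ o).seq
        (gate_does wH wT wC g n _ _ _ o))
    have h2 := ih ((g.ctrlCode wH wT wC).reverse ++ true :: y) (true :: h)
    have h3 : Does (gates d wH wT wC) _ _ _ := popInp_next (b := true) rfl h1 h2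
    have e : (g :: gs).flatMap (fun g => true :: g.code) ++ [false] =
        true :: (g.code ++ (gs.flatMap (fun g => true :: g.code) ++ [false])) := by simp
    rw [e]
    refine Does.to h3 ?_ ?_
    · simp [List.replicate_succ, replicate_append_cons]
    · simp only [List.length_append, List.length_cons]
      generalize wH.length + wT.length + wC.length = K
      have : 2 * g.code.length ≤ (K + 35) * g.code.length := Nat.mul_le_mul_right _ (by omega)
      simp only [Nat.mul_add, Nat.mul_succ] at this ⊢
      omega

/-- Read the number of qubits. -/
def header (d : ℕ) : Prog (Reg d) :=
  popLoop .inp (fun o => o == some true) fun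
    | some true => push .hdr true
    | _ => skip

lemma header_does (m n : ℕ) (x y h o : List Bool) :
    Does (header d) (regs n (codeNat m ++ x) y h o)
      (regs n x y (List.replicate m true ++ h) o) (2 * m + 2) := by
  induction m generalizing h with
  | zero => exact popInp_exit rfl (skip_does _)
  | succ m ih =>
    refine (popInp_next rfl (push_hdr_does true n (codeNat m ++ x) y h o)
      (ih (true :: h))).to ?_ (by omega)
    simp [List.replicate_succ, replicate_append_cons]

/-- Translate the code of a circuit, which is given in reverse order on the stack `aux`. -/
def transform (d : ℕ) (wH wT wC : List Bool) (rot : List (Bool ⊕ ℕ)) : Prog (Reg d) :=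
  Frag.seq (move .aux .inp) <| Frag.seq (header d) <| Frag.seq (gates d wH wT wC) <|
  Frag.seq (move .aux .out) <| Frag.seq (emitText d rot) <| Frag.seq (push .out false) <|
  Frag.seq (move .hdr .out) <| Frag.seq (push .out true) (clearAll d)

lemma length_ctrlCode_le (wH wT wC : List Bool) {m : ℕ} (g : StdGate m) :
    (g.ctrlCode wH wT wC).length ≤
      (wH.length + wT.length + wC.length + 10) * g.code.length := by
  have h0 : ∀ i, shiftWire i ≤ i + 1 := fun i => by unfold shiftWire; split_ifs <;> omega
  have h1 : ∀ a b : ℕ, 1 ≤ b → a ≤ a * b := fun a b h => Nat.le_mul_of_pos_right a h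
  have h2 : 1 ≤ g.code.length := by cases g <;> simp [StdGate.code, codeNat]
  have h3 := h1 (wH.length + wT.length + wC.length) _ h2
  rw [Nat.add_mul]
  refine le_trans ?_ (Nat.add_le_add_right h3 _)
  cases g with
  | h i =>
    have := h0 i
    simp [StdGate.code, StdGate.ctrlCode, codeNat]; omega
  | t i =>
    have := h0 i
    simp [StdGate.code, StdGate.ctrlCode, codeNat]; omega
  | cx a b _ =>
    have := h0 a
    have := h0 b
    simp [StdGate.code, StdGate.ctrlCode, codeNat]; omega

lemma length_ctrlCodes_le (wH wT wC : List Bool) {m : ℕ} (gs : List (StdGate m)) :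
    (gs.flatMap fun g => true :: g.ctrlCode wH wT wC).length ≤
      (wH.length + wT.length + wC.length + 10) *
        (gs.flatMap fun g => true :: g.code).length := by
  induction gs with
  | nil => simp
  | cons g gs ih =>
    have := length_ctrlCode_le wH wT wC g
    simp only [List.flatMap_cons, List.length_append, List.length_cons, Nat.mul_add]
    omega

/-- The output is built from its end: the translated gates, then the rotation in front of them, and
finally the number of qubits, which is known only once the gates have been counted. The last `true`
accounts for the control qubit. -/
lemma transform_does (wH wT wC : List Bool) (rot : List (Bool ⊕ ℕ))
    (hrot : ∀ e, Sum.inr e ∈ rot → e ≤ d) :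
    ∃ Q : Polynomial ℕ, ∀ (n : ℕ) (C : Circuit StdGate),
      Does (transform d wH wT wC rot)
        (regs n [] (C.code fun _ g => g.code).reverse [] [])
        (regs 0 [] [] [] (codeNat (C.numQubits + C.gates.length + 1) ++
          (textVal n rot ++ (C.gates.flatMap (fun g => true :: g.ctrlCode wH wT wC) ++ [false]))))
        (Q.eval (n + (C.code fun _ g => g.code).length)) := by
  obtain ⟨P, hP⟩ := emitText_does rot hrot
  -- `P` pays for the rotation; everything else is linear in `n` and the length of the code, with a
  -- factor that depends only on `d` and on the fixed matrix codes.
  refine ⟨P + Polynomial.C (2 * d + 4 * (wH.length + wT.length + wC.length) + 100) *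
    (Polynomial.X + 1), fun n C => ?_⟩
  generalize hK : wH.length + wT.length + wC.length = K
  obtain ⟨m, hm, gs⟩ := C
  have hcode : ((⟨m, hm, gs⟩ : Circuit StdGate).code fun _ g => g.code) = codeNat m ++
    (gs.flatMap (fun g => true :: g.code) ++ [false]) := by
    simp [Circuit.code]
  have hgs : gs.length ≤ (gs.flatMap (fun g => true :: g.code)).length := by
    clear hcode
    induction gs with
    | nil => simp
    | cons g gs ih => simp at ih ⊢; omega
  have hct := length_ctrlCodes_le wH wT wC gs
  rw [hcode]
  have h1 := move_does (a := Reg.aux) (b := Reg.inp) (by simp)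
    (regs n [] (codeNat m ++ (gs.flatMap (fun g => true :: g.code) ++ [false])).reverse [] []
      : Reg d → _)
  have h2 := header_does (d := d) m n (gs.flatMap (fun g => true :: g.code) ++ [false]) [] [] []
  have h3 := gates_does (d := d) wH wT wC gs n [] (List.replicate m true ++ []) []
  have h4 := move_does (a := Reg.aux) (b := Reg.out) (by simp)
    (regs n [] ((gs.flatMap (fun g => true :: g.ctrlCode wH wT wC) ++ [false]).reverse ++ [])
      (List.replicate gs.length true ++ (List.replicate m true ++ [])) [] : Reg d → _)
  have h5 := hP n [] [] (List.replicate gs.length true ++ (List.replicate m true ++ []))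
    (gs.flatMap (fun g => true :: g.ctrlCode wH wT wC) ++ [false])
  have h6 := push_does .out false (regs n [] []
    (List.replicate gs.length true ++ (List.replicate m true ++ [])) (textVal n rot ++
    (gs.flatMap (fun g => true :: g.ctrlCode wH wT wC) ++ [false])) : Reg d → _)
  have h7 := move_does (a := Reg.hdr) (b := Reg.out) (by simp) (regs n [] []
    (List.replicate gs.length true ++ (List.replicate m true ++ [])) (false :: (textVal n rot ++
    (gs.flatMap (fun g => true :: g.ctrlCode wH wT wC) ++ [false]))) : Reg d → _)
  have h8 := push_does .out true (regs n [] [] []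
    ((List.replicate gs.length true ++ (List.replicate m true ++ [])).reverse ++
    false :: (textVal n rot ++
    (gs.flatMap (fun g => true :: g.ctrlCode wH wT wC) ++ [false]))) : Reg d → _)
  have h9 := clearAll_does (d := d) n [] [] []
    (true :: ((List.replicate gs.length true ++ (List.replicate m true ++ [])).reverse ++
    false :: (textVal n rot ++
    (gs.flatMap (fun g => true :: g.ctrlCode wH wT wC) ++ [false]))))
  refine Does.to ((h1.to (by simp) le_rfl).seq (h2.seq (h3.seq ((h4.to (by simp) le_rfl).seq
    (h5.seq ((h6.to (by simp) le_rfl).seq ((h7.to (by simp) le_rfl).seq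
    ((h8.to (by simp) le_rfl).seq h9)))))))) ?_ ?_
  · congr 1
    have : m + gs.length + 1 = (gs.length + m) + 1 := by omega
    rw [this]
    simp only [codeNat, List.append_nil, List.reverse_append, List.reverse_replicate,
      List.replicate_succ, List.replicate_add, List.cons_append, List.append_assoc,
      List.nil_append]
    rw [← List.append_assoc, ← List.append_assoc (List.replicate gs.length true),
      ← List.replicate_add, ← List.replicate_add, Nat.add_comm]
  · simp only [regs_aux, regs_hdr, List.append_nil, List.length_reverse, List.length_append,
      List.length_replicate, codeNat, List.length_cons, List.length_nil, Polynomial.eval_add,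
      Polynomial.eval_mul, Polynomial.eval_C, Polynomial.eval_X, Polynomial.eval_one]
    rw [hK] at hct ⊢
    generalize (gs.flatMap (fun g => true :: g.code)).length = c at *
    generalize (gs.flatMap fun g => true :: g.ctrlCode wH wT wC).length = c' at *
    have hmono : P.eval n ≤ P.eval (n + (m + (0 + 1) + (c + (0 + 1)))) :=
      eval_mono_nat P (by omega)
    generalize P.eval (n + (m + (0 + 1) + (c + (0 + 1)))) = p at *
    nlinarith [Nat.zero_le (d * m), Nat.zero_le (d * c), Nat.zero_le (K * n),
      Nat.zero_le (K * m), Nat.zero_le (K * c), Nat.zero_le d, Nat.zero_le (d * n)]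

end Prog

/-! ### Gates and wires -/

section Extend

variable {k n : ℕ} (w : Fin k ↪ Fin n)

lemma extend_wires (y : Fin k → Bool) (x : Fin n → Bool) (i : Fin k) :
    Function.extend w y x (w i) = y i := w.injective.extend_apply _ _ _

lemma extend_comp_wires (y : Fin k → Bool) (x : Fin n → Bool) :
    Function.extend w y x ∘ w = y := funext fun i => extend_wires w y x i

lemma extend_off (y : Fin k → Bool) (x : Fin n → Bool) {j : Fin n} (hj : ∀ i, w i ≠ j) :
    Function.extend w y x j = x j :=
  Function.extend_apply' _ _ _ fun ⟨i, hi⟩ => hj i hi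

lemma extend_extend (y z : Fin k → Bool) (x : Fin n → Bool) :
    Function.extend w y (Function.extend w z x) = Function.extend w y x := by
  funext j
  by_cases hj : ∃ i, w i = j
  · obtain ⟨i, rfl⟩ := hj
    rw [extend_wires, extend_wires]
  · push Not at hj
    rw [extend_off w _ _ hj, extend_off w _ _ hj, extend_off w _ _ hj]

lemma extend_self (x : Fin n → Bool) : Function.extend w (x ∘ w) x = x := by
  funext j
  by_cases hj : ∃ i, w i = j
  · obtain ⟨i, rfl⟩ := hj
    rw [extend_wires, Function.comp_apply]
  · push Not at hj
    rw [extend_off w _ _ hj]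

/-- Exchange the bits on the wires with a string of bits. -/
def swapWires : (Fin n → Bool) × (Fin k → Bool) ≃ (Fin n → Bool) × (Fin k → Bool) where
  toFun p := (Function.extend w p.2 p.1, p.1 ∘ w)
  invFun p := (Function.extend w p.2 p.1, p.1 ∘ w)
  left_inv p := by simp [extend_comp_wires, extend_extend, extend_self]
  right_inv p := by simp [extend_comp_wires, extend_extend, extend_self]

/-- Exchanging the bits on the wires with the string `y` is a bijection of pairs, after which the
second component is free and contributes the factor `2 ^ k`. -/
lemma sum_sum_extend (F : (Fin n → Bool) → ℝ) :
    ∑ x, ∑ y : Fin k → Bool, F (Function.extend w y x) = 2 ^ k * ∑ x, F x := by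
  have := (swapWires w).sum_comp fun p => F p.1
  simp only [swapWires, Equiv.coe_fn_mk] at this
  rw [Fintype.sum_prod_type, Fintype.sum_prod_type] at this
  rw [this, Finset.mul_sum]
  simp

end Extend

lemma sum_norm_sq_mulVec {ι : Type} [Fintype ι] [DecidableEq ι] {U : Matrix ι ι ℂ}
    (hU : U ∈ Matrix.unitaryGroup ι ℂ) (v : ι → ℂ) :
    ∑ i, ‖U.mulVec v i‖ ^ 2 = ∑ i, ‖v i‖ ^ 2 := by
  have h : ∀ u : ι → ℂ, ((∑ i, ‖u i‖ ^ 2 : ℝ) : ℂ) = star u ⬝ᵥ u := fun u => by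
    rw [dotProduct]
    push_cast
    exact Finset.sum_congr rfl fun i _ => (Complex.conj_mul' (u i)).symm
  have h2 : star (U.mulVec v) ⬝ᵥ U.mulVec v = star v ⬝ᵥ v := by
    rw [Matrix.star_mulVec, Matrix.dotProduct_mulVec, Matrix.vecMul_vecMul,
      ← Matrix.star_eq_conjTranspose, Matrix.mem_unitaryGroup_iff'.1 hU, Matrix.vecMul_one]
  exact_mod_cast (h _).trans (h2.trans (h v).symm)

/-- For a fixed `x`, the gate acts on the amplitudes of all strings that agree with `x` off the
wires as its own unitary matrix. Summing over `x` counts each string `2 ^ arity` times on both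
sides. -/
lemma Gate.sum_norm_sq_apply {n : ℕ} (g : Gate n) (ψ : State n) :
    ∑ x, ‖g.apply ψ x‖ ^ 2 = ∑ x, ‖ψ x‖ ^ 2 := by
  have h : (2 : ℝ) ^ g.arity ≠ 0 := by positivity
  apply mul_left_cancel₀ h
  rw [← sum_sum_extend g.wires fun x => ‖g.apply ψ x‖ ^ 2,
    ← sum_sum_extend g.wires fun x => ‖ψ x‖ ^ 2]
  refine Finset.sum_congr rfl fun x _ => ?_
  rw [← sum_norm_sq_mulVec g.unitary fun y => ψ (Function.extend g.wires y x)]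
  refine Finset.sum_congr rfl fun y _ => ?_
  simp only [Gate.apply, extend_comp_wires, extend_extend]
  rfl

lemma sum_norm_sq_foldl {n : ℕ} (gs : List (Gate n)) (ψ : State n) :
    ∑ x, ‖gs.foldl (fun ψ g => g.apply ψ) ψ x‖ ^ 2 = ∑ x, ‖ψ x‖ ^ 2 := by
  induction gs generalizing ψ with
  | nil => rfl
  | cons g gs ih => rw [List.foldl_cons, ih, g.sum_norm_sq_apply]

lemma sum_norm_sq_finalState {n : ℕ} (gs : List (Gate n)) :
    ∑ x, ‖finalState gs x‖ ^ 2 = 1 := by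
  rw [finalState, sum_norm_sq_foldl, Finset.sum_eq_single fun _ => false]
  · simp [zeroState]
  · intro x _ hx
    simp [zeroState, hx]
  · simp

/-! ### Trace distance to `|0⟩` -/

-- Cauchy–Schwarz for the nonzero singular values: their number is the rank, and the sum of their
-- squares is the trace of `Aᴴ * A`.
open scoped ComplexOrder in
lemma traceNorm_sq_le {ι : Type} [Fintype ι] [DecidableEq ι] (A : Matrix ι ι ℂ) :
    traceNorm A ^ 2 ≤ A.rank * (Matrix.trace (A.conjTranspose * A)).re := by
  have hA := Matrix.isHermitian_conjTranspose_mul_self A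
  have hnn : ∀ i, 0 ≤ hA.eigenvalues i :=
    (Matrix.posSemidef_conjTranspose_mul_self A).eigenvalues_nonneg
  have htr : (Matrix.trace (A.conjTranspose * A)).re = ∑ i, hA.eigenvalues i := by
    rw [hA.trace_eq_sum_eigenvalues]
    simp
  have hrk : A.rank = Fintype.card {i // hA.eigenvalues i ≠ 0} := by
    rw [← hA.rank_eq_card_non_zero_eigs, Matrix.rank_conjTranspose_mul_self]
  let s := Finset.univ.filter fun i => hA.eigenvalues i ≠ 0
  have h1 : traceNorm A = ∑ i ∈ s, Real.sqrt (hA.eigenvalues i) := by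
    rw [traceNorm, Finset.sum_filter]
    refine Finset.sum_congr rfl fun i _ => ?_
    split_ifs with h
    · rfl
    · push Not at h
      rw [h, Real.sqrt_zero]
  have h2 : ∑ i, hA.eigenvalues i = ∑ i ∈ s, Real.sqrt (hA.eigenvalues i) ^ 2 := by
    rw [Finset.sum_filter]
    refine Finset.sum_congr rfl fun i _ => ?_
    rw [Real.sq_sqrt (hnn i)]
    split_ifs with h
    · rfl
    · push Not at h
      exact h
  rw [h1, htr, h2, hrk, Fintype.card_subtype]
  exact sq_sum_le_card_mul_sum_sq

/-- The difference of the two rank-one projections has rank at most `2` and squared Hilbert–Schmidt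
norm `2 (1 - |⟨0|ψ⟩|²)`, so `traceNorm_sq_le` bounds its squared trace norm by `4 (1 - |⟨0|ψ⟩|²)`.
-/
lemma traceDist_zeroState_le {n : ℕ} (ψ : State n) (hψ : ∑ x, ‖ψ x‖ ^ 2 = 1) :
    traceDist ψ (zeroState n) ≤ Real.sqrt (1 - ‖ψ fun _ => false‖ ^ 2) := by
  have hρ : ∀ φ : State n, ∑ x, ‖φ x‖ ^ 2 = 1 → star φ ⬝ᵥ φ = 1 := fun φ h => by
    rw [dotProduct, ← Complex.ofReal_one, ← h]
    push_cast
    exact Finset.sum_congr rfl fun i _ => Complex.conj_mul' (φ i)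
  have h0 := hρ (zeroState n) (sum_norm_sq_finalState (n := n) [])
  have h1 := hρ ψ hψ
  have hz : star (zeroState n) ⬝ᵥ ψ = ψ fun _ => false := by
    have : star (zeroState n) = zeroState n := by
      funext x
      by_cases h : x = fun _ => false
      · subst h; simp [zeroState]
      · simp [zeroState, h]
    rw [this, zeroState, single_dotProduct, one_mul]
  have hz' : star ψ ⬝ᵥ zeroState n = star (ψ fun _ => false) := by
    rw [← hz, Matrix.star_dotProduct]
  have hherm : ∀ φ : State n, (density φ).conjTranspose = density φ := fun φ => by
    rw [density, Matrix.conjTranspose_vecMulVec, star_star]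
  -- The difference factors through a two-dimensional space.
  have hrank : (density ψ - density (zeroState n)).rank ≤ 2 := by
    have : density ψ - density (zeroState n) =
        (Matrix.of fun x (j : Fin 2) => (![ψ x, zeroState n x] j : ℂ)) *
          Matrix.of fun (j : Fin 2) y => (![star (ψ y), -star (zeroState n y)] j : ℂ) := by
      ext x y
      simp [density, Matrix.mul_apply, Matrix.vecMulVec_apply, sub_eq_add_neg]
    rw [this]
    exact (Matrix.rank_mul_le_left _ _).trans
      ((Matrix.rank_le_card_width _).trans (by simp))
  have htr : Matrix.trace ((density ψ - density (zeroState n)).conjTranspose *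
      (density ψ - density (zeroState n))) = 2 * (1 - (‖ψ fun _ => false‖ ^ 2 : ℝ)) := by
    rw [Matrix.conjTranspose_sub, hherm, hherm, sub_mul, mul_sub, mul_sub]
    have hc : ∀ φ χ : State n, φ ⬝ᵥ star χ = star χ ⬝ᵥ φ := fun φ χ => dotProduct_comm _ _
    simp only [density, Matrix.vecMulVec_mul_vecMulVec, Matrix.trace_sub,
      Matrix.trace_vecMulVec, h0, h1, hz, hz', one_smul, dotProduct_smul, hc, smul_eq_mul,
      Complex.star_def, Complex.conj_mul', Complex.mul_conj']
    push_cast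
    ring
  have key := traceNorm_sq_le (density ψ - density (zeroState n))
  rw [htr] at key
  have hle : ‖ψ fun _ => false‖ ^ 2 ≤ 1 := by
    rw [← hψ]
    exact Finset.single_le_sum (f := fun x => ‖ψ x‖ ^ 2) (fun _ _ => by positivity)
      (Finset.mem_univ _)
  have key2 : traceNorm (density ψ - density (zeroState n)) ^ 2 ≤
      2 * (2 * (1 - ‖ψ fun _ => false‖ ^ 2)) := by
    have e : (2 * (1 - ((‖ψ fun _ => false‖ ^ 2 : ℝ) : ℂ))).re =
        2 * (1 - ‖ψ fun _ => false‖ ^ 2) := by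
      rw [← Complex.ofReal_one, ← Complex.ofReal_sub, ← Complex.ofReal_ofNat,
        ← Complex.ofReal_mul, Complex.ofReal_re]
    rw [e] at key
    refine key.trans (mul_le_mul_of_nonneg_right (by exact_mod_cast hrank) ?_)
    linarith
  rw [traceDist]
  apply Real.le_sqrt_of_sq_le
  rw [mul_pow]
  linarith

/-! ### Controlled gates -/

lemma sum_fin_succ_bool {k : ℕ} {M : Type} [AddCommMonoid M] (F : (Fin (k + 1) → Bool) → M) :
    ∑ y, F y = (∑ z : Fin k → Bool, F (Fin.cons true z)) + ∑ z : Fin k → Bool,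
      F (Fin.cons false z) := by
  rw [← (Fin.consEquiv fun _ => Bool).sum_comp, Fintype.sum_prod_type, Fintype.sum_bool]
  rfl

/-- The matrix of the gate `U` controlled by a qubit, which is the first one. -/
def ctrlMat {k : ℕ} (U : QubitMatrix k) : QubitMatrix (k + 1) := fun x y =>
  if x 0 = y 0 then
    if x 0 then U (Fin.tail x) (Fin.tail y) else if Fin.tail x = Fin.tail y then 1 else 0
  else 0

/-- The matrix is block diagonal with blocks `1` and `U`; the four cases are the blocks of the
product. -/
lemma ctrlMat_unitary {k : ℕ} {U : QubitMatrix k}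
    (hU : U ∈ Matrix.unitaryGroup (Fin k → Bool) ℂ) :
    ctrlMat U ∈ Matrix.unitaryGroup (Fin (k + 1) → Bool) ℂ := by
  rw [Matrix.mem_unitaryGroup_iff]
  have hU' := Matrix.mem_unitaryGroup_iff.1 hU
  ext x y
  obtain ⟨a, x, rfl⟩ : ∃ a x', x = Fin.cons a x' := ⟨x 0, Fin.tail x, (Fin.cons_self_tail x).symm⟩
  obtain ⟨b, y, rfl⟩ : ∃ b y', y = Fin.cons b y' := ⟨y 0, Fin.tail y, (Fin.cons_self_tail y).symm⟩
  have h := congrFun (congrFun hU' x) y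
  rw [Matrix.mul_apply, Matrix.one_apply] at h
  rw [Matrix.mul_apply, Matrix.one_apply, sum_fin_succ_bool]
  simp only [Matrix.star_apply] at h ⊢
  have hcons : (Fin.cons a x : Fin (k + 1) → Bool) = Fin.cons b y ↔ a = b ∧ x = y :=
    Fin.cons_inj
  simp only [hcons]
  cases a <;> cases b
  · simp [ctrlMat]
  · simp [ctrlMat]
  · simp [ctrlMat]
  · simpa [ctrlMat] using h

/-- The coefficients of the controlled gate. -/
def ctrlCoeff {k : ℕ} (c : (Fin k → Bool) → (Fin k → Bool) → Fin 4 → ℚ) :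
    (Fin (k + 1) → Bool) → (Fin (k + 1) → Bool) → Fin 4 → ℚ := fun x y =>
  if x 0 = y 0 then
    if x 0 then c (Fin.tail x) (Fin.tail y)
    else if Fin.tail x = Fin.tail y then Pi.single 0 1 else 0
  else 0

lemma cyclo_zero : cyclo 0 = 0 := by simp [cyclo]

lemma cyclo_single_zero : cyclo (Pi.single 0 1) = 1 := by
  simp [cyclo, Fin.sum_univ_four]

lemma cyclo_vec (a b c e : ℚ) :
    cyclo ![a, b, c, e] = a + b * zeta + c * zeta ^ 2 + e * zeta ^ 3 := by
  simp [cyclo, Fin.sum_univ_four]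

lemma of_cyclo_ctrlCoeff {k : ℕ} {c : (Fin k → Bool) → (Fin k → Bool) → Fin 4 → ℚ}
    {U : QubitMatrix k} (h : ∀ x y, cyclo (c x y) = U x y) :
    (Matrix.of fun x y => cyclo (ctrlCoeff c x y)) = ctrlMat U := by
  ext x y
  simp only [Matrix.of_apply, ctrlCoeff, ctrlMat]
  split_ifs
  · exact h _ _
  · exact cyclo_single_zero
  · exact cyclo_zero
  · exact cyclo_zero

lemma zeta_eq : zeta = (Real.sqrt 2 / 2 : ℝ) + (Real.sqrt 2 / 2 : ℝ) * Complex.I := by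
  rw [zeta, Complex.exp_mul_I, ← Complex.ofReal_cos, ← Complex.ofReal_sin, Real.cos_pi_div_four,
    Real.sin_pi_div_four]

lemma sqrt_two_sq : ((Real.sqrt 2 : ℝ) : ℂ) ^ 2 = 2 := by
  rw [← Complex.ofReal_pow, Real.sq_sqrt (by norm_num)]
  norm_num

lemma zeta_sq : zeta ^ 2 = Complex.I := by
  have h := sqrt_two_sq
  have hI := Complex.I_sq
  rw [zeta_eq]
  push_cast
  linear_combination (1 / 4 * (1 + 2 * Complex.I + Complex.I ^ 2)) * h + (1 / 2) * hI

/-- This puts the Hadamard gate into the field: `1 / √2 = (ζ - ζ³) / 2`. -/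
lemma zeta_sub_zeta_cube : zeta - zeta ^ 3 = (Real.sqrt 2 : ℝ) := by
  have hI := Complex.I_sq
  rw [pow_succ, zeta_sq, zeta_eq]
  push_cast
  linear_combination (-((Real.sqrt 2 : ℝ) : ℂ) / 2) * hI

/-- The coefficients of the Hadamard gate. -/
def hadamardCoeff : (Fin 1 → Bool) → (Fin 1 → Bool) → Fin 4 → ℚ := fun x y =>
  if x 0 && y 0 then ![0, -1 / 2, 0, 1 / 2] else ![0, 1 / 2, 0, -1 / 2]

/-- The coefficients of the phase gate. -/
def phaseTCoeff : (Fin 1 → Bool) → (Fin 1 → Bool) → Fin 4 → ℚ := fun x y =>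
  if x = y then if x 0 then ![0, 1, 0, 0] else ![1, 0, 0, 0] else 0

/-- The coefficients of the CNOT gate. -/
def cnotCoeff : (Fin 2 → Bool) → (Fin 2 → Bool) → Fin 4 → ℚ := fun x y =>
  if x 0 = y 0 ∧ x 1 = xor (y 0) (y 1) then ![1, 0, 0, 0] else 0

lemma cyclo_hadamardCoeff (x y) : cyclo (hadamardCoeff x y) = hadamard x y := by
  have h0 : ((Real.sqrt 2 : ℝ) : ℂ) ≠ 0 := by
    simp
  have h : 1 / ((Real.sqrt 2 : ℝ) : ℂ) = (zeta - zeta ^ 3) / 2 := by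
    rw [zeta_sub_zeta_cube, div_eq_div_iff h0 two_ne_zero]
    linear_combination -sqrt_two_sq
  rw [hadamard, hadamardCoeff]
  split_ifs
  · rw [cyclo_vec]
    push_cast
    linear_combination h
  · rw [cyclo_vec]
    push_cast
    linear_combination -h

lemma cyclo_phaseTCoeff (x y) : cyclo (phaseTCoeff x y) = phaseT x y := by
  rw [phaseT, phaseTCoeff, Matrix.diagonal_apply]
  split_ifs <;> simp [cyclo_vec, cyclo_zero]

lemma cyclo_cnotCoeff (x y) : cyclo (cnotCoeff x y) = cnot x y := by
  rw [cnot, cnotCoeff]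
  split_ifs <;> simp [cyclo_vec, cyclo_zero]

/-! ### Controlled circuits on an embedded register -/

section Embed

variable {m n : ℕ} (f : Fin m ↪ Fin n) (c : Fin n) (hc : ∀ i, f i ≠ c)

/-- The wires of a controlled gate: the control qubit `c`, and the wires of the gate on the
register that is embedded by `f`. -/
def ctrlWires {k : ℕ} (w : Fin k ↪ Fin m) : Fin (k + 1) ↪ Fin n :=
  ⟨Fin.cons c (f ∘ w), Fin.cons_injective_iff.2
    ⟨fun ⟨i, hi⟩ => hc (w i) hi, f.injective.comp w.injective⟩⟩

/-- Overwriting the control bit with the value it already has changes nothing. -/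
lemma extend_ctrlWires {k : ℕ} (w : Fin k ↪ Fin m) (b : Bool) (z : Fin k → Bool)
    (x : Fin n → Bool) (hx : x c = b) :
    Function.extend (ctrlWires f c hc w) (Fin.cons b z) x = Function.extend (w.trans f) z x := by
  funext j
  by_cases hj : ∃ i, w.trans f i = j
  · obtain ⟨i, rfl⟩ := hj
    rw [extend_wires]
    exact extend_wires (ctrlWires f c hc w) _ x i.succ
  · push Not at hj
    rw [extend_off _ _ _ hj]
    by_cases hjc : c = j
    · subst hjc
      rw [hx]
      exact extend_wires (ctrlWires f c hc w) _ x 0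
    · refine extend_off _ _ _ fun i => ?_
      refine Fin.cases hjc hj i

lemma sum_ctrlMat {k : ℕ} (U : QubitMatrix k) (w : Fin k ↪ Fin m) (Ψ : State n)
    (x : Fin n → Bool) :
    ∑ y, ctrlMat U (x ∘ ctrlWires f c hc w) y *
      Ψ (Function.extend (ctrlWires f c hc w) y x) =
    if x c then ∑ z, U (x ∘ w.trans f) z * Ψ (Function.extend (w.trans f) z x) else Ψ x := by
  have h0 : (x ∘ ctrlWires f c hc w) 0 = x c := rfl
  have ht : Fin.tail (x ∘ ctrlWires f c hc w) = x ∘ w.trans f := rfl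
  rw [sum_fin_succ_bool]
  simp only [ctrlMat, h0, ht, Fin.cons_zero, Fin.tail_cons]
  cases hx : x c
  · simp [extend_ctrlWires f c hc w false _ x hx, extend_self]
  · simp [extend_ctrlWires f c hc w true _ x hx]

/-- The controlled version of a letter of the universal gate set. -/
def StdGate.ctrl : StdGate m → ExactGate n
  | .h i => ⟨2, by norm_num, ctrlWires f c hc (wire1 i), ctrlCoeff hadamardCoeff, by
      rw [of_cyclo_ctrlCoeff cyclo_hadamardCoeff]; exact ctrlMat_unitary hadamard_unitary⟩
  | .t i => ⟨2, by norm_num, ctrlWires f c hc (wire1 i), ctrlCoeff phaseTCoeff, by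
      rw [of_cyclo_ctrlCoeff cyclo_phaseTCoeff]; exact ctrlMat_unitary phaseT_unitary⟩
  | .cx a b ne => ⟨3, by norm_num, ctrlWires f c hc (wire2 a b ne), ctrlCoeff cnotCoeff, by
      rw [of_cyclo_ctrlCoeff cyclo_cnotCoeff]; exact ctrlMat_unitary cnot_unitary⟩

lemma StdGate.ctrl_apply (g : StdGate m) (Ψ : State n) (x : Fin n → Bool) :
    (g.ctrl f c hc).toGate.apply Ψ x =
      if x c then ∑ z, g.toGate.mat (x ∘ g.toGate.wires.trans f) z *
        Ψ (Function.extend (g.toGate.wires.trans f) z x) else Ψ x := by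
  cases g with
  | h i =>
    refine Eq.trans ?_ (sum_ctrlMat f c hc hadamard (wire1 i) Ψ x)
    rw [← of_cyclo_ctrlCoeff cyclo_hadamardCoeff]
    rfl
  | t i =>
    refine Eq.trans ?_ (sum_ctrlMat f c hc phaseT (wire1 i) Ψ x)
    rw [← of_cyclo_ctrlCoeff cyclo_phaseTCoeff]
    rfl
  | cx a b ne =>
    refine Eq.trans ?_ (sum_ctrlMat f c hc cnot (wire2 a b ne) Ψ x)
    rw [← of_cyclo_ctrlCoeff cyclo_cnotCoeff]
    rfl

/-- All qubits other than `c` and those of the embedded register are `0`. -/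
def IdleZero (x : Fin n → Bool) : Prop := ∀ j, (∀ i, f i ≠ j) → j ≠ c → x j = false

open scoped Classical in
/-- The superposition of `|0⟩` with amplitude `α` and, where the qubit `c` is `1` and the embedded
register is in the state `ψ`, with amplitude `β`. -/
def branchState (α β : ℂ) (ψ : State m) : State n := fun x =>
  (if x = fun _ => false then α else 0) +
    if x c = true ∧ IdleZero f c x then β * ψ (x ∘ f) else 0

variable {f c}

/-- The invariant of the computation. The branch `|0…0⟩` has control `0` and is fixed; in the other
one the control is `1`, and the gate acts on the embedded register without touching the control or
the idle qubits. -/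
lemma StdGate.ctrl_apply_branchState (hc : ∀ i, f i ≠ c) (g : StdGate m) (α β : ℂ)
    (ψ : State m) :
    (g.ctrl f c hc).toGate.apply (branchState f c α β ψ) =
      branchState f c α β (g.toGate.apply ψ) := by
  classical
  funext x
  rw [StdGate.ctrl_apply]
  cases hx : x c
  · simp [branchState, hx]
  · have hx0 : x ≠ fun _ => false := fun h => by simp [h] at hx
    have hcz : ∀ z, Function.extend (g.toGate.wires.trans f) z x c = true := fun z => by
      rw [extend_off (g.toGate.wires.trans f) _ _ fun i => hc _, hx]
    have hz0 : ∀ z, Function.extend (g.toGate.wires.trans f) z x ≠ fun _ => false :=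
      fun z h => by
        have := hcz z
        rw [h] at this
        simp at this
    have hidle : ∀ z, IdleZero f c (Function.extend (g.toGate.wires.trans f) z x) ↔
        IdleZero f c x := fun z => by
      refine forall_congr' fun j => imp_congr_right fun hj => ?_
      rw [extend_off (g.toGate.wires.trans f) _ _ fun i => hj _]
    have hcomp : ∀ z, Function.extend (g.toGate.wires.trans f) z x ∘ f =
        Function.extend g.toGate.wires z (x ∘ f) := fun z => by
      funext j
      by_cases hj : ∃ i, g.toGate.wires i = j
      · obtain ⟨i, rfl⟩ := hj
        rw [extend_wires]
        exact extend_wires (g.toGate.wires.trans f) z x i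
      · push Not at hj
        rw [extend_off _ _ _ hj, Function.comp_apply, extend_off, Function.comp_apply]
        exact fun i h => hj i (f.injective h)
    simp only [branchState, hx0, hz0, hcz, hx, hidle, hcomp, if_true, if_false, true_and,
      zero_add]
    split_ifs with hI
    · rw [Gate.apply, Finset.mul_sum]
      refine Finset.sum_congr rfl fun z _ => ?_
      rw [mul_left_comm]
      rfl
    · simp

lemma foldl_ctrl_branchState (hc : ∀ i, f i ≠ c) (gs : List (StdGate m)) (α β : ℂ)
    (ψ : State m) :
    (gs.map fun g => (g.ctrl f c hc).toGate).foldl (fun ψ g => g.apply ψ)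
      (branchState f c α β ψ) =
      branchState f c α β ((gs.map StdGate.toGate).foldl (fun ψ g => g.apply ψ) ψ) := by
  induction gs generalizing ψ with
  | nil => rfl
  | cons g gs ih =>
    simp only [List.map_cons, List.foldl_cons]
    rw [StdGate.ctrl_apply_branchState, ih]

/-- The second branch vanishes at `0…0`, where the control is `0`. So the overlap with `|0…0⟩` does
not depend on `ψ`, whatever the original circuit does. -/
lemma branchState_zero (α β : ℂ) (ψ : State m) :
    branchState f c α β ψ (fun _ => false) = α := by
  simp [branchState]

/-- A basis state with outcome `1` is not `0…0`, so only the second branch contributes. Its support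
is in bijection with the strings of the embedded register. -/
lemma probOne_branchState (hc : ∀ i, f i ≠ c) (α β : ℂ) (ψ : State m) (i : Fin m) :
    probOne (branchState f c α β ψ) (f i) = ‖β‖ ^ 2 * probOne ψ i := by
  classical
  rw [probOne, probOne, Finset.mul_sum]
  have h1 : ∀ x : Fin n → Bool, (if x (f i) then ‖branchState f c α β ψ x‖ ^ 2 else 0) =
      if x c = true ∧ IdleZero f c x then
        ‖β‖ ^ 2 * (if (x ∘ f) i then ‖ψ (x ∘ f)‖ ^ 2 else 0) else 0 := by
    intro x
    by_cases hx : x (f i) = true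
    · have hx0 : x ≠ fun _ => false := fun h => by simp [h] at hx
      simp only [hx, if_true, branchState, hx0, if_false, zero_add, Function.comp_apply]
      split_ifs
      · rw [norm_mul, mul_pow]
      · simp
    · simp [hx]
  simp_rw [h1]
  rw [← Finset.sum_filter]
  refine Finset.sum_bij' (fun x _ => x ∘ f)
    -- Off the embedded register, the control is set to `1` and the idle qubits to `0`.
    (fun y _ => Function.extend f y fun j => decide (j = c)) (fun _ _ => Finset.mem_univ _)
    ?_ ?_ ?_ fun _ _ => rfl
  · intro y _
    rw [Finset.mem_filter]
    refine ⟨Finset.mem_univ _, ?_, fun j hj hjc => ?_⟩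
    · rw [extend_off f _ _ hc]; simp
    · rw [extend_off f _ _ hj]; simp [hjc]
  · intro x hx
    obtain ⟨_, hxc, hx⟩ := Finset.mem_filter.1 hx
    funext j
    by_cases hj : ∃ i, f i = j
    · obtain ⟨i, rfl⟩ := hj
      rw [extend_wires, Function.comp_apply]
    · push Not at hj
      rw [extend_off f _ _ hj]
      by_cases hjc : j = c
      · subst hjc; simp [hxc]
      · rw [hx j hj hjc]; simp [hjc]
  · intro y _
    exact extend_comp_wires f y _

end Embed

/-! ### The small rotation -/

/-- The coefficients of the rotation of the control qubit. -/
def rotCoeff (N : ℕ) : (Fin 1 → Bool) → (Fin 1 → Bool) → Fin 4 → ℚ := fun x y =>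
  if x 0 = y 0 then ![N ^ 2 / (N ^ 2 + 1), 0, N / (N ^ 2 + 1), 0]
  else ![1 / (N ^ 2 + 1), 0, -N / (N ^ 2 + 1), 0]

/-- The diagonal entries of the rotation. -/
def rotDiag (N : ℕ) : ℂ := (N ^ 2 + N * Complex.I) / (N ^ 2 + 1)

/-- The off-diagonal entries of the rotation. -/
def rotOff (N : ℕ) : ℂ := (1 - N * Complex.I) / (N ^ 2 + 1)

lemma cyclo_rotCoeff (N : ℕ) (x y) :
    cyclo (rotCoeff N x y) = if x 0 = y 0 then rotDiag N else rotOff N := by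
  rw [rotCoeff]
  split_ifs
  · rw [cyclo_vec, zeta_sq, rotDiag]
    push_cast
    ring
  · rw [cyclo_vec, zeta_sq, rotOff]
    push_cast
    ring

lemma natCast_sq_add_one_ne_zero (N : ℕ) : (N : ℂ) ^ 2 + 1 ≠ 0 := by
  exact_mod_cast Nat.succ_ne_zero (N ^ 2)

/-- The matrix is `(N - i)⁻¹` times the one with diagonal `N` and off-diagonal `-i`: a rotation
about the X axis with tangent `1 / N`, times a phase. Without the phase the entries would involve
`√(N² + 1)`, in general outside the field; the phase is harmless. -/
lemma rotation_unitary (N : ℕ) :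
    (Matrix.of fun x y => cyclo (rotCoeff N x y)) ∈ Matrix.unitaryGroup (Fin 1 → Bool) ℂ := by
  have hN := natCast_sq_add_one_ne_zero N
  have hI := Complex.I_sq
  have h1 : rotDiag N * star (rotDiag N) + rotOff N * star (rotOff N) = 1 := by
    simp only [rotDiag, rotOff, Complex.star_def, map_div₀, map_add, map_sub, map_mul, map_pow,
      Complex.conj_natCast, Complex.conj_I, map_one]
    field_simp
    linear_combination (-2 * (N : ℂ) ^ 2) * hI
  have h2 : rotDiag N * star (rotOff N) + rotOff N * star (rotDiag N) = 0 := by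
    simp only [rotDiag, rotOff, Complex.star_def, map_div₀, map_add, map_sub, map_mul, map_pow,
      Complex.conj_natCast, Complex.conj_I, map_one]
    field_simp
    linear_combination (2 * (N : ℂ) ^ 2) * hI
  rw [Matrix.mem_unitaryGroup_iff]
  ext x y
  rw [Matrix.mul_apply, ← (Equiv.funUnique (Fin 1) Bool).symm.sum_comp, Fintype.sum_bool,
    Matrix.one_apply]
  have hxy : x = y ↔ x 0 = y 0 := by
    constructor
    · rintro rfl; rfl
    · intro h; funext i; rw [Subsingleton.elim i 0]; exact h
  simp only [Matrix.star_apply, Matrix.of_apply, cyclo_rotCoeff, hxy]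
  cases hx : x 0 <;> cases hy : y 0 <;>
    simp [Equiv.funUnique, -Complex.star_def, -RCLike.star_def] <;>
    first | exact h1 | exact h2 | (rw [add_comm]; first | exact h1 | exact h2)

lemma norm_rotOff_sq (N : ℕ) : ‖rotOff N‖ ^ 2 = 1 / ((N : ℝ) ^ 2 + 1) := by
  have h : ((‖rotOff N‖ ^ 2 : ℝ) : ℂ) = ((1 / ((N : ℝ) ^ 2 + 1) : ℝ) : ℂ) := by
    have hN := natCast_sq_add_one_ne_zero N
    have hI := Complex.I_sq
    rw [Complex.ofReal_pow, ← Complex.mul_conj']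
    simp only [rotOff, map_div₀, map_add, map_sub, map_mul, map_pow,
      Complex.conj_natCast, Complex.conj_I, map_one]
    push_cast
    field_simp
    linear_combination (-(N : ℂ) ^ 2) * hI
  exact_mod_cast h

lemma norm_rotDiag_sq (N : ℕ) : 1 - ‖rotDiag N‖ ^ 2 = 1 / ((N : ℝ) ^ 2 + 1) := by
  have h : ((1 - ‖rotDiag N‖ ^ 2 : ℝ) : ℂ) = ((1 / ((N : ℝ) ^ 2 + 1) : ℝ) : ℂ) := by
    have hN := natCast_sq_add_one_ne_zero N
    have hI := Complex.I_sq
    rw [Complex.ofReal_sub, Complex.ofReal_pow, ← Complex.mul_conj']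
    simp only [rotDiag, map_div₀, map_add, map_mul, map_pow,
      Complex.conj_natCast, Complex.conj_I, map_one]
    push_cast
    field_simp
    linear_combination ((N : ℂ) ^ 2) * hI
  exact_mod_cast h

/-- The rotation of the qubit `c`. -/
def rotation {n : ℕ} (c : Fin n) (N : ℕ) : ExactGate n :=
  ⟨1, by norm_num, wire1 c, rotCoeff N, rotation_unitary N⟩

/-- This starts the invariant: the rotated state has the two-branch form with `|0⟩^m` in the
embedded register. -/
lemma rotation_apply_zeroState {m n : ℕ} {f : Fin m ↪ Fin n} {c : Fin n} (hc : ∀ i, f i ≠ c)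
    (N : ℕ) :
    (rotation c N).toGate.apply (zeroState n) =
      branchState f c (rotDiag N) (rotOff N) (zeroState m) := by
  classical
  funext x
  change ∑ y : Fin 1 → Bool, cyclo (rotCoeff N (x ∘ wire1 c) y) *
    zeroState n (Function.extend (wire1 c) y x) = _
  have hz : ∀ b : Bool, (Function.extend (wire1 c) (fun _ => b) x = fun _ => false) ↔
      b = false ∧ ∀ j, j ≠ c → x j = false := by
    intro b
    constructor
    · intro h
      refine ⟨?_, fun j hj => ?_⟩
      · rw [← extend_wires (wire1 c) (fun _ => b) x 0, h]
      · rw [← extend_off (wire1 c) (fun _ => b) x fun i => Ne.symm hj, h]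
    · rintro ⟨rfl, h⟩
      funext j
      by_cases hj : j = c
      · subst hj
        exact extend_wires (wire1 j) _ x 0
      · rw [extend_off (wire1 c) _ x fun i => Ne.symm hj, h j hj]
  have hzs : ∀ {k : ℕ} (x : Fin k → Bool), zeroState k x = if x = fun _ => false then 1 else 0 :=
    fun x => by rw [zeroState, Pi.single_apply]
  rw [← (Equiv.funUnique (Fin 1) Bool).symm.sum_comp, Fintype.sum_bool]
  have hs : ∀ b : Bool, (Equiv.funUnique (Fin 1) Bool).symm b = fun _ => b := fun b => rfl
  have hcx : (x ∘ wire1 c) 0 = x c := rfl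
  simp only [hs, hzs, hz, cyclo_rotCoeff, branchState, hcx]
  have h0 : (x = fun _ => false) ↔ x c = false ∧ ∀ j, j ≠ c → x j = false := by
    constructor
    · rintro rfl; simp
    · rintro ⟨h1, h2⟩
      funext j
      by_cases hj : j = c
      · rw [hj, h1]
      · exact h2 j hj
  have h1 : (IdleZero f c x ∧ x ∘ f = fun _ => false) ↔ ∀ j, j ≠ c → x j = false := by
    constructor
    · rintro ⟨h1, h2⟩ j hj
      by_cases hf : ∃ i, f i = j
      · obtain ⟨i, rfl⟩ := hf
        exact congrFun h2 i
      · push Not at hf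
        exact h1 j hf hj
    · intro h
      exact ⟨fun j _ hj => h j hj, funext fun i => h _ (hc i)⟩
  simp only [h0]
  by_cases hI : ∀ j, j ≠ c → x j = false
  · obtain ⟨h2, h3⟩ := h1.2 hI
    simp only [eq_true hI, h2, h3]
    cases hx : x c <;> simp
  · have : ¬ (IdleZero f c x ∧ x ∘ f = fun _ => false) := fun h => hI (h1.1 h)
    by_cases h2 : IdleZero f c x
    · have h3 : x ∘ f ≠ fun _ => false := fun h => this ⟨h2, h⟩
      simp only [eq_false hI, h3]
      simp
    · simp only [eq_false hI, h2]
      simp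

/-! ### Independent runs -/

/-- The expectation of a function of the number of outcomes `1` in `N` independent runs. -/
def countExp (q : ℝ) (N : ℕ) (F : ℕ → ℝ) : ℝ :=
  ∑ o : Fin N → Bool, (∏ i, if o i then q else 1 - q) * F ((List.ofFn o).count true)

lemma countExp_succ (q : ℝ) (N : ℕ) (F : ℕ → ℝ) :
    countExp q (N + 1) F = q * countExp q N (fun c => F (c + 1)) + (1 - q) * countExp q N F := by
  rw [countExp, sum_fin_succ_bool, countExp, countExp, Finset.mul_sum, Finset.mul_sum]
  congr 1 <;> refine Finset.sum_congr rfl fun o _ => ?_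
  · simp [Fin.prod_univ_succ, List.ofFn_succ, mul_assoc]
  · simp [Fin.prod_univ_succ, List.ofFn_succ, mul_assoc]

lemma countExp_one (q : ℝ) (N : ℕ) : countExp q N (fun _ => 1) = 1 := by
  induction N with
  | zero => simp [countExp]
  | succ N ih => rw [countExp_succ, ih]; ring

/-- Variance plus squared bias. The centre `a` is arbitrary because a first outcome `1` moves it to
`a - 1` in the induction on `N`. -/
lemma countExp_sub_sq (q : ℝ) (N : ℕ) (a : ℝ) :
    countExp q N (fun c => (c - a) ^ 2) = N * q * (1 - q) + (N * q - a) ^ 2 := by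
  induction N generalizing a with
  | zero => simp [countExp]
  | succ N ih =>
    have h : countExp q N (fun c => (((c + 1 : ℕ) : ℝ) - a) ^ 2) =
        countExp q N (fun c => ((c : ℝ) - (a - 1)) ^ 2) := by
      congr 1
      funext c
      push_cast
      ring
    rw [countExp_succ, h, ih, ih]
    push_cast
    ring

lemma probRuns_add_not (q : ℝ) (N : ℕ) (post : List Bool → Bool) :
    probRuns q N post + probRuns q N (fun o => !post o) = 1 := by
  rw [← countExp_one q N, probRuns, probRuns, countExp, ← Finset.sum_add_distrib]
  refine Finset.sum_congr rfl fun o _ => ?_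
  cases post (List.ofFn o) <;> simp

/-- Chebyshev's inequality. -/
lemma sq_mul_probRuns_le {q : ℝ} (hq0 : 0 ≤ q) (hq1 : q ≤ 1) (N : ℕ) (post : List Bool → Bool)
    (t : ℝ) (h : ∀ o, post o = true → t ^ 2 ≤ ((o.count true : ℕ) - N * q) ^ 2) :
    t ^ 2 * probRuns q N post ≤ N * q := by
  have h1 : t ^ 2 * probRuns q N post ≤ countExp q N fun c => (c - N * q) ^ 2 := by
    rw [probRuns, countExp, Finset.mul_sum]
    refine Finset.sum_le_sum fun o _ => ?_
    have hp : 0 ≤ ∏ i, (if o i then q else 1 - q) :=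
      Finset.prod_nonneg fun i _ => by split_ifs <;> linarith
    by_cases ho : post (List.ofFn o) = true
    · rw [if_pos ho, mul_comm]
      exact mul_le_mul_of_nonneg_left (h _ ho) hp
    · rw [if_neg ho, mul_zero]
      exact mul_nonneg hp (sq_nonneg _)
  -- At the centre `N * q` only the variance `N * q * (1 - q)` remains, which is at most `N * q`.
  rw [countExp_sub_sq, sub_self] at h1
  have : 0 ≤ (N : ℝ) * q := by positivity
  nlinarith

/-- The test whether there are at least `36` outcomes `1`. -/
def manyOnes (p : List Bool × List Bool) : Bool := decide (36 ≤ p.2.count true)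

lemma two_thirds_le_probRuns {q : ℝ} (hq0 : 0 ≤ q) (hq1 : q ≤ 1) {N : ℕ} (h : 48 ≤ N * q)
    (x : List Bool) : 2 / 3 ≤ probRuns q N fun o => manyOnes (x, o) := by
  have h1 := probRuns_add_not q N fun o => manyOnes (x, o)
  have h2 := sq_mul_probRuns_le hq0 hq1 N (fun o => !manyOnes (x, o)) (N * q - 36) (by
    intro o ho
    have : o.count true < 36 := by simpa [manyOnes] using ho
    have : ((o.count true : ℕ) : ℝ) < 36 := by exact_mod_cast this
    nlinarith)
  -- With mean `μ = N * q`, the error is at most `μ / (μ - 36)²`, and this is at most `1/3` because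
  -- `(μ - 36)² - 3 μ = (μ - 48) (μ - 27)` is nonnegative for `μ ≥ 48`.
  nlinarith [mul_nonneg (sub_nonneg.2 h) (by linarith : (0 : ℝ) ≤ N * q - 27)]

lemma probRuns_le_one_third {q : ℝ} (hq0 : 0 ≤ q) (hq1 : q ≤ 1) {N : ℕ} (h : N * q ≤ 24)
    (x : List Bool) : (probRuns q N fun o => manyOnes (x, o)) ≤ 1 / 3 := by
  have h2 := sq_mul_probRuns_le hq0 hq1 N (fun o => manyOnes (x, o)) (36 - N * q) (by
    intro o ho
    have : 36 ≤ o.count true := by simpa [manyOnes] using ho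
    have : (36 : ℝ) ≤ ((o.count true : ℕ) : ℝ) := by exact_mod_cast this
    nlinarith)
  -- The same quadratic as for the yes-instances; here both factors are nonpositive, since `N * q ≤
  -- 24`.
  nlinarith [mul_nonneg (by linarith : (0 : ℝ) ≤ 48 - N * q)
    (by linarith : (0 : ℝ) ≤ 27 - N * q)]

/-- Increase a number, up to `36`. -/
def satSucc (c : Fin 37) : Fin 37 := ⟨min ((c : ℕ) + 1) 36, by omega⟩

/-- The machine that tests whether there are at least `36` outcomes `1`: the stack `false` is the
input, the stack `true` is the output, and the variable counts the outcomes `1` up to `36`. -/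
def manyOnesMachine : FinTM2 where
  K := Bool
  k₀ := false
  k₁ := true
  Γ b := cond b Bool (Bool ⊕ Bool)
  Λ := Unit
  main := ()
  σ := Fin 37 × Bool
  initialState := (0, false)
  Γk₀Fin := (inferInstance : Fintype (Bool ⊕ Bool))
  m _ := .pop false
    (fun v (o : Option (Bool ⊕ Bool)) =>
      (if o = some (Sum.inr true) then satSucc v.1 else v.1, o.isSome))
    (.branch Prod.snd (.goto fun _ => ())
      (.push true (fun v => (decide (v.1 = 36) : Bool)) (.load (fun _ => (0, false)) .halt)))

/-- A count that saturates at `36` fits into a finite variable and still decides the test. Letters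
of the input string, marked `Sum.inl`, are skipped, and the variable is reset before halting. -/
lemma manyOnesMachine_steps (l : List (Bool ⊕ Bool)) (c : Fin 37) (b : Bool) :
    Steps manyOnesMachine.m (l.length + 1)
      ⟨some (), (c, b), Function.update (β := fun k => List (manyOnesMachine.Γ k))
        (fun _ => []) false l⟩
      ⟨none, (0, false), Function.update (β := fun k => List (manyOnesMachine.Γ k))
        (fun _ => []) true [decide (36 ≤ (c : ℕ) + l.countP fun a => decide (a = Sum.inr true))]⟩ := by
  induction l generalizing c b with
  | nil =>
    refine Steps.single ?_
    have hd : decide (c = 36) = decide (36 ≤ (c : ℕ) + ([] : List (Bool ⊕ Bool)).countP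
        fun a => decide (a = Sum.inr true)) := by
      rw [decide_eq_decide, Fin.ext_iff, List.countP_nil]
      have : ((36 : Fin 37) : ℕ) = 36 := rfl
      omega
    rw [← hd]
    refine congrArg (fun S => (⟨none, (0, false), S⟩ : manyOnesMachine.Cfg)) ?_
    funext k
    cases k <;> rfl
  | cons a l ih =>
    let c' : Fin 37 := if some a = some (Sum.inr true) then satSucc c else c
    have hc : decide (36 ≤ (c : ℕ) + (a :: l).countP fun a => decide (a = Sum.inr true)) =
        decide (36 ≤ (c' : ℕ) + l.countP fun a => decide (a = Sum.inr true)) := by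
      rw [decide_eq_decide, List.countP_cons]
      by_cases ha : a = Sum.inr true
      · have : (c' : ℕ) = min ((c : ℕ) + 1) 36 := by simp [c', ha, satSucc]
        rw [this, ha]
        simp only [decide_true, if_true]
        omega
      · have : (c' : ℕ) = c := by simp [c', ha]
        rw [this]
        simp [ha]
    rw [hc]
    refine .head ?_
    have e : TM2.stepAux (manyOnesMachine.m ()) (c, b)
        (Function.update (β := fun k => List (manyOnesMachine.Γ k)) (fun _ => []) false (a :: l)) =
        ⟨some (), (c', true), Function.update (β := fun k => List (manyOnesMachine.Γ k))
          (fun _ => []) false l⟩ := by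
      refine congrArg (fun S => (⟨some (), (c', true), S⟩ : manyOnesMachine.Cfg)) ?_
      funext k
      cases k <;> rfl
    exact e ▸ ih c' true

/-- The test `manyOnes` is computable in polynomial time. -/
theorem manyOnes_polyTime :
    Nonempty (TM2ComputableInPolyTime codePair Computability.encodeBool manyOnes) := by
  refine ⟨⟨⟨manyOnesMachine, Equiv.refl (Bool ⊕ Bool), Equiv.refl Bool⟩, Polynomial.X + 1,
    fun p => ⟨⟨(codePair p).length + 1, ?_⟩, by simp⟩⟩⟩
  have h := (manyOnesMachine_steps (codePair p) 0 false).iterate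
  have e₁ : initList manyOnesMachine (List.map (Equiv.refl (Bool ⊕ Bool)).invFun (codePair p)) =
      ⟨some (), (0, false), Function.update (β := fun k => List (manyOnesMachine.Γ k))
        (fun _ => []) false (codePair p)⟩ := by
    have := (initList_stk manyOnesMachine (List.map (Equiv.refl (Bool ⊕ Bool)).invFun
      (codePair p))).trans (congrArg (fun y => Function.update
      (β := fun k => List (manyOnesMachine.Γ k)) (fun _ => []) false y)
        (List.map_id (codePair p)))
    rw [← this]
    rfl
  have hd : decide (36 ≤ ((0 : Fin 37) : ℕ) + (codePair p).countP fun a => decide (a = Sum.inr true)) = manyOnes p := by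
    have : ((codePair p).countP fun a => decide (a = Sum.inr true)) = p.2.count true := by
      rw [codePair, List.countP_append, List.countP_map, List.countP_map, List.count]
      simp [Function.comp_def]
    rw [this, manyOnes]
    simp
  have e₂ : haltList manyOnesMachine (List.map (Equiv.refl Bool).invFun
      (Computability.encodeBool (manyOnes p))) =
      ⟨none, (0, false), Function.update (β := fun k => List (manyOnesMachine.Γ k))
        (fun _ => []) true [manyOnes p]⟩ := by
    have := haltList_stk manyOnesMachine (List.map (Equiv.refl Bool).invFun
      (Computability.encodeBool (manyOnes p)))
    refine Eq.trans ?_ (congrArg (fun S => (⟨none, (0, false), S⟩ : manyOnesMachine.Cfg)) this)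
    rfl
  rw [e₁]
  rw [hd] at h
  exact h.trans (congrArg some e₂.symm)

/-! ### The circuits for the restricted quantum computer -/

/-- The embedding of a register of `m` qubits into a larger one, which leaves the qubit `1` and
the last `g` qubits free. -/
def shiftEmb (m g : ℕ) : Fin m ↪ Fin (m + g + 1) where
  toFun i := ⟨shiftWire i, by unfold shiftWire; split_ifs <;> omega⟩
  inj' i j h := by
    have : shiftWire i = shiftWire j := congrArg Fin.val h
    unfold shiftWire at this
    split_ifs at this <;> omega

/-- The control qubit. -/
def ctrlQubit (C : Circuit StdGate) : Fin (C.numQubits + C.gates.length + 1) :=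
  ⟨1, by have := C.pos; omega⟩

lemma shiftEmb_ne_ctrlQubit (C : Circuit StdGate) (i : Fin C.numQubits) :
    shiftEmb C.numQubits C.gates.length i ≠ ctrlQubit C := by
  intro h
  have : shiftWire i = 1 := congrArg Fin.val h
  unfold shiftWire at this
  split_ifs at this
  omega

/-- The circuit that rotates the control qubit by a small angle and then runs the circuit `C` in
a controlled way. -/
def smallCircuit (N : ℕ) (C : Circuit StdGate) : Circuit ExactGate where
  numQubits := C.numQubits + C.gates.length + 1
  pos := Nat.succ_pos _
  gates := rotation (ctrlQubit C) N :: C.gates.map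
    (StdGate.ctrl (shiftEmb C.numQubits C.gates.length) (ctrlQubit C) (shiftEmb_ne_ctrlQubit C))

lemma finalState_smallCircuit_take (N : ℕ) (C : Circuit StdGate) (t : ℕ) :
    finalState (((smallCircuit N C).gates.take (t + 1)).map ExactGate.toGate) =
      branchState (shiftEmb C.numQubits C.gates.length) (ctrlQubit C) (rotDiag N) (rotOff N)
        (finalState ((C.gates.take t).map StdGate.toGate)) := by
  change finalState (((rotation (ctrlQubit C) N :: C.gates.map _).take (t + 1)).map
    ExactGate.toGate) = _
  rw [List.take_succ_cons, List.map_cons, finalState, List.foldl_cons,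
    rotation_apply_zeroState (shiftEmb_ne_ctrlQubit C), ← List.map_take, List.map_map]
  exact foldl_ctrl_branchState (shiftEmb_ne_ctrlQubit C) _ _ _ _

/-- The embedding keeps qubit `0` in place, so the measured qubit is that of the original circuit;
this is why the control is put at position `1`. -/
lemma accProb_smallCircuit (N : ℕ) (C : Circuit StdGate) :
    (smallCircuit N C).accProb (fun _ g => g.toGate) =
      C.accProb (fun _ g => g.toGate) / ((N : ℝ) ^ 2 + 1) := by
  have h := finalState_smallCircuit_take N C C.gates.length
  have hl : (smallCircuit N C).gates.length = C.gates.length + 1 := by simp [smallCircuit]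
  rw [← hl, List.take_length, List.take_length] at h
  have h0 : (⟨0, (smallCircuit N C).pos⟩ : Fin (smallCircuit N C).numQubits) =
      shiftEmb C.numQubits C.gates.length ⟨0, C.pos⟩ := Fin.ext (by simp [shiftEmb, shiftWire])
  rw [Circuit.accProb, h0]
  change probOne (finalState ((smallCircuit N C).gates.map ExactGate.toGate)) _ = _
  rw [h]
  refine (probOne_branchState (shiftEmb_ne_ctrlQubit C) _ _ _ _).trans ?_
  rw [norm_rotOff_sq, Circuit.accProb]
  ring

/-- After the rotation the distance is at most `√(1 - |α|²)`, where `1 - |α|² = 1 / (N² + 1) ≤ (1 /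
N)²`; before it the state is `|0…0⟩` itself. -/
lemma smallCircuit_mem_QC {ε : ℕ → ℝ} (N : ℕ) (C : Circuit StdGate)
    (hε : 1 / (N : ℝ) ≤ ε (C.numQubits + C.gates.length + 1)) (hN : 0 < N) :
    smallCircuit N C ∈ QC ε := by
  have hN' : (0 : ℝ) < N := by exact_mod_cast hN
  intro t _
  refine ⟨sum_norm_sq_finalState _, (traceDist_zeroState_le _ (sum_norm_sq_finalState _)).trans
    (le_trans ?_ hε)⟩
  rw [Real.sqrt_le_left (by positivity)]
  rcases t with _ | t
  · have : finalState (((smallCircuit N C).gates.take 0).map ExactGate.toGate) =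
        zeroState _ := rfl
    have h1 : zeroState (smallCircuit N C).numQubits (fun _ => false) = 1 := Pi.single_eq_same _ _
    rw [this, h1, norm_one, one_pow, sub_self]
    positivity
  · rw [finalState_smallCircuit_take]
    have h := branchState_zero (f := shiftEmb C.numQubits C.gates.length) (c := ctrlQubit C)
      (rotDiag N) (rotOff N) (finalState ((C.gates.take t).map StdGate.toGate))
    have h2 := norm_rotDiag_sq N
    rw [← h] at h2
    refine h2.le.trans ?_
    rw [div_pow, one_pow]
    exact one_div_le_one_div_of_le (by positivity) (by linarith)

lemma accProb_nonneg (C : Circuit StdGate) : 0 ≤ C.accProb fun _ g => g.toGate :=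
  Finset.sum_nonneg fun x _ => by split_ifs <;> positivity

lemma accProb_le_one (C : Circuit StdGate) : (C.accProb fun _ g => g.toGate) ≤ 1 := by
  rw [← sum_norm_sq_finalState (C.gates.map StdGate.toGate), Circuit.accProb, probOne]
  refine Finset.sum_le_sum fun x _ => ?_
  split_ifs
  · exact le_rfl
  · positivity

/-! ### The codes of the circuits -/

/-- The code of the matrix of a gate. -/
def matCode {k : ℕ} (c : (Fin k → Bool) → (Fin k → Bool) → Fin 4 → ℚ) : List Bool :=
  (bitStrings k).flatMap fun x => (bitStrings k).flatMap fun y =>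
    (List.ofFn (c x y)).flatMap codeRat

/-- Only the wires vary with the gate; the three matrix codes are constants, so the program can
carry them as literals. -/
lemma code_ctrl (C : Circuit StdGate) (g : StdGate C.numQubits) :
    (StdGate.ctrl (shiftEmb C.numQubits C.gates.length) (ctrlQubit C)
      (shiftEmb_ne_ctrlQubit C) g).code =
    g.ctrlCode (matCode (ctrlCoeff hadamardCoeff)) (matCode (ctrlCoeff phaseTCoeff))
      (matCode (ctrlCoeff cnotCoeff)) := by
  cases g with
  | h i =>
    change codeNat 2 ++ (List.ofFn fun j : Fin 2 => ((ctrlWires (shiftEmb C.numQubits _)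
      (ctrlQubit C) (shiftEmb_ne_ctrlQubit C) (wire1 i) j : Fin _) : ℕ)).flatMap codeNat ++
      matCode (ctrlCoeff hadamardCoeff) = _
    simp [List.ofFn_succ, ctrlWires, ctrlQubit, wire1, shiftEmb, StdGate.ctrlCode]
    rfl
  | t i =>
    change codeNat 2 ++ (List.ofFn fun j : Fin 2 => ((ctrlWires (shiftEmb C.numQubits _)
      (ctrlQubit C) (shiftEmb_ne_ctrlQubit C) (wire1 i) j : Fin _) : ℕ)).flatMap codeNat ++
      matCode (ctrlCoeff phaseTCoeff) = _
    simp [List.ofFn_succ, ctrlWires, ctrlQubit, wire1, shiftEmb, StdGate.ctrlCode]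
    rfl
  | cx a b ne =>
    change codeNat 3 ++ (List.ofFn fun j : Fin 3 => ((ctrlWires (shiftEmb C.numQubits _)
      (ctrlQubit C) (shiftEmb_ne_ctrlQubit C) (wire2 a b ne) j : Fin _) : ℕ)).flatMap codeNat ++
      matCode (ctrlCoeff cnotCoeff) = _
    simp [List.ofFn_succ, ctrlWires, ctrlQubit, wire2, shiftEmb, StdGate.ctrlCode]
    rfl

/-- The code refers to the reduced fraction, so coprimality is needed to read off numerator and
denominator. -/
lemma codeRat_div {a b : ℕ} (hb : 0 < b) (h : a.Coprime b) :
    codeRat ((a : ℚ) / b) = false :: (codeNat a ++ codeNat b) := by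
  have hb' : (0 : ℤ) < b := by exact_mod_cast hb
  have h1 : ((a : ℚ) / b).num = a := by
    have := Rat.num_div_eq_of_coprime (a := a) (b := b) hb' (by simpa using h)
    rwa [Int.cast_natCast, Int.cast_natCast] at this
  have h2 : (((a : ℚ) / b).den : ℤ) = b := by
    have := Rat.den_div_eq_of_coprime (a := a) (b := b) hb' (by simpa using h)
    rwa [Int.cast_natCast, Int.cast_natCast] at this
  have h3 : ¬ ((a : ℚ) / b < 0) := not_lt.2 (by positivity)
  rw [codeRat, h1, Int.natCast_inj.1 h2]
  simp [h3]

lemma codeRat_neg_div {a b : ℕ} (ha : 0 < a) (hb : 0 < b) (h : a.Coprime b) :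
    codeRat (-(a : ℚ) / b) = true :: (codeNat a ++ codeNat b) := by
  have hb' : (0 : ℤ) < b := by exact_mod_cast hb
  have h1 : (-(a : ℚ) / b).num = -a := by
    have := Rat.num_div_eq_of_coprime (a := -a) (b := b) hb' (by simpa using h)
    exact_mod_cast this
  have h2 : ((-(a : ℚ) / b).den : ℤ) = b := by
    have := Rat.den_div_eq_of_coprime (a := -a) (b := b) hb' (by simpa using h)
    exact_mod_cast this
  have h3 : -(a : ℚ) / b < 0 := by
    rw [neg_div]
    exact neg_lt_zero.2 (by positivity)
  rw [codeRat, h1, Int.natCast_inj.1 h2]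
  simp [h3]

/-- The text of a string of bits. -/
def litText (w : List Bool) : List (Bool ⊕ ℕ) := w.map Sum.inl

/-- The text of a rational number, with sign `s`, the numerator given by the text `a`, and the
denominator `(n + 2) ^ (2 * j) + 1`. -/
def ratText (j : ℕ) (s : Bool) (a : List (Bool ⊕ ℕ)) : List (Bool ⊕ ℕ) :=
  Sum.inl s :: (a ++ litText [false] ++ ([Sum.inr (2 * j)] ++ litText [true, false]))

/-- The text of a diagonal entry of the rotation. -/
def diagText (j : ℕ) : List (Bool ⊕ ℕ) :=
  ratText j false [Sum.inr (2 * j)] ++ litText (codeRat 0) ++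
    (ratText j false [Sum.inr j] ++ litText (codeRat 0))

/-- The text of an off-diagonal entry of the rotation. -/
def offText (j : ℕ) : List (Bool ⊕ ℕ) :=
  ratText j false (litText [true]) ++ litText (codeRat 0) ++
    (ratText j true [Sum.inr j] ++ litText (codeRat 0))

/-- The text of the first gate of the circuit. -/
def rotText (j : ℕ) : List (Bool ⊕ ℕ) :=
  litText (true :: (codeNat 1 ++ codeNat 1)) ++
    ((diagText j ++ offText j) ++ (offText j ++ diagText j))

lemma textVal_append (n : ℕ) (v w : List (Bool ⊕ ℕ)) :
    Prog.textVal n (v ++ w) = Prog.textVal n v ++ Prog.textVal n w := List.flatMap_append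

lemma textVal_litText (n : ℕ) (w : List Bool) : Prog.textVal n (litText w) = w := by
  induction w with
  | nil => rfl
  | cons b w ih => exact congrArg (b :: ·) ih

lemma textVal_inr (n e : ℕ) :
    Prog.textVal n [Sum.inr e] = List.replicate ((n + 2) ^ e) true := by
  simp [Prog.textVal]

lemma textVal_ratText (n j : ℕ) (s : Bool) {a : List (Bool ⊕ ℕ)} {c : ℕ}
    (ha : Prog.textVal n a = List.replicate c true) :
    Prog.textVal n (ratText j s a) =
      s :: (codeNat c ++ codeNat (((n + 2) ^ j) ^ 2 + 1)) := by
  have h : Prog.textVal n (ratText j s a) = s :: Prog.textVal n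
    (a ++ litText [false] ++ ([Sum.inr (2 * j)] ++ litText [true, false])) := rfl
  rw [h, textVal_append, textVal_append, textVal_append, textVal_litText, textVal_litText,
    textVal_inr, ha, codeNat, codeNat, ← pow_mul, Nat.mul_comm j 2, List.replicate_add]
  simp

lemma ofFn_cons_four (a b c e : ℚ) : List.ofFn ![a, b, c, e] = [a, b, c, e] := by
  simp [List.ofFn_succ]

lemma code_rotation {m : ℕ} (c : Fin m) (hc : (c : ℕ) = 1) (n j : ℕ) :
    true :: (rotation c ((n + 2) ^ j)).code = Prog.textVal n (rotText j) := by
  generalize hN : (n + 2) ^ j = N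
  have hpos : 0 < N := hN ▸ Nat.pow_pos (by omega)
  have hb : 0 < N ^ 2 + 1 := Nat.succ_pos _
  -- All entries are already in lowest terms, so the program can write numerators and denominators
  -- without computing a gcd.
  have c1 : (N ^ 2).Coprime (N ^ 2 + 1) := by simp
  have c2 : N.Coprime (N ^ 2 + 1) := by
    rw [pow_two]
    simp
  have e1 := codeRat_div hb c1
  have e2 := codeRat_div hb c2
  have e3 := codeRat_div (a := 1) hb (by simp)
  have e4 := codeRat_neg_div hpos hb c2
  push_cast at e1 e2 e3 e4
  have hdiag : Prog.textVal n (diagText j) = (List.ofFn ![(N : ℚ) ^ 2 / (N ^ 2 + 1), 0,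
      (N : ℚ) / (N ^ 2 + 1), 0]).flatMap codeRat := by
    rw [diagText, textVal_append, textVal_append, textVal_append,
      textVal_ratText n j false (textVal_inr n (2 * j)), textVal_ratText n j false
      (textVal_inr n j), textVal_litText, Nat.mul_comm 2 j, pow_mul, hN, ofFn_cons_four]
    simp only [List.flatMap_cons, List.flatMap_nil, e1, e2, List.append_nil, List.append_assoc]
  have hoff : Prog.textVal n (offText j) = (List.ofFn ![1 / ((N : ℚ) ^ 2 + 1), 0,
      -(N : ℚ) / (N ^ 2 + 1), 0]).flatMap codeRat := by
    rw [offText, textVal_append, textVal_append, textVal_append,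
      textVal_ratText n j false (c := 1) (textVal_litText n [true]), textVal_ratText n j true
      (textVal_inr n j), textVal_litText, hN, ofFn_cons_four]
    simp only [List.flatMap_cons, List.flatMap_nil, e3, e4, List.append_nil, List.append_assoc]
  have hbits : bitStrings 1 = [fun _ => false, fun _ => true] := by
    have : (List.range (2 ^ 1)) = [0, 1] := rfl
    rw [bitStrings, this]
    simp only [List.map_cons, List.map_nil, List.cons.injEq, and_true]
    constructor <;> funext i <;> fin_cases i <;> rfl
  have hcode : (rotation c N).code = codeNat 1 ++
      (List.ofFn fun i : Fin 1 => ((wire1 c i : Fin m) : ℕ)).flatMap codeNat ++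
      matCode (rotCoeff N) := rfl
  rw [hcode, rotText, textVal_append, textVal_append, textVal_append, textVal_append,
    textVal_litText, hdiag, hoff, matCode, hbits]
  simp [rotCoeff, wire1, List.ofFn_succ]
  exact congrArg codeNat hc

lemma code_smallCircuit (n j : ℕ) (C : Circuit StdGate) :
    (smallCircuit ((n + 2) ^ j) C).code (fun _ g => g.code) =
      codeNat (C.numQubits + C.gates.length + 1) ++ (Prog.textVal n (rotText j) ++
        (C.gates.flatMap (fun g => true :: g.ctrlCode (matCode (ctrlCoeff hadamardCoeff))
          (matCode (ctrlCoeff phaseTCoeff)) (matCode (ctrlCoeff cnotCoeff))) ++ [false])) := by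
  rw [Circuit.code, ← code_rotation (ctrlQubit C) rfl n j]
  change codeNat (C.numQubits + C.gates.length + 1) ++ ((rotation (ctrlQubit C) ((n + 2) ^ j) ::
    C.gates.map (StdGate.ctrl (shiftEmb C.numQubits C.gates.length) (ctrlQubit C)
    (shiftEmb_ne_ctrlQubit C))).flatMap fun g => true :: g.code) ++ [false] = _
  rw [List.flatMap_cons, List.flatMap_map]
  simp only [code_ctrl, List.append_assoc]

/-- The transformed circuits can be computed in polynomial time. -/
theorem smallCircuit_polyTime {circ : List Bool → Circuit StdGate}
    (h : TM2ComputableInPolyTime (id : List Bool → List Bool)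
      (Circuit.code fun _ g => g.code) circ) (j : ℕ) :
    Nonempty (TM2ComputableInPolyTime (id : List Bool → List Bool)
      (Circuit.code fun _ g => g.code)
      fun x => smallCircuit ((x.length + 2) ^ j) (circ x)) := by
  obtain ⟨P, hP⟩ := exists_length_le h
  -- The largest power in the text of the rotation is `N² = (n + 2) ^ (2 * j)`, hence `2 * j`
  -- counters.
  obtain ⟨Q, hQ⟩ := Prog.transform_does (d := 2 * j) (matCode (ctrlCoeff hadamardCoeff))
    (matCode (ctrlCoeff phaseTCoeff)) (matCode (ctrlCoeff cnotCoeff)) (rotText j) (by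
      intro e he
      simp [rotText, diagText, offText, ratText, litText] at he
      omega)
  have h0 : ∀ s : List Bool, Function.update (fun _ => []) .inp s =
      (Prog.regs 0 s [] [] [] : Reg (2 * j) → _) := by
    intro s; funext k; cases k <;> simp [Prog.regs]
  have h1 : ∀ s : List Bool, Function.update (fun _ => []) .out s =
      (Prog.regs 0 [] [] [] s : Reg (2 * j) → _) := by
    intro s; funext k; cases k <;> simp [Prog.regs]
  refine polyTime_of_wrap h (R := Reg (2 * j)) .inp .aux .out (Prog.readInput (2 * j))
    (Prog.transform (2 * j) (matCode (ctrlCoeff hadamardCoeff))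
      (matCode (ctrlCoeff phaseTCoeff)) (matCode (ctrlCoeff cnotCoeff)) (rotText j))
    -- During the call of the given machine the counters keep the length of the input.
    (fun x => Prog.regs x.length [] [] [] [])
    (Polynomial.C (2 * j + 3) * Polynomial.X + 2) (Q.comp (Polynomial.X + P)) ?_ ?_
  · intro x
    rw [h0]
    exact (Prog.readInput_does 0 x [] [] []).to (by simp) (by simp)
  · intro x
    rw [h1, Prog.update_regs_aux, code_smallCircuit]
    refine (hQ x.length (circ x)).mono ?_
    rw [Polynomial.eval_comp, Polynomial.eval_add, Polynomial.eval_X]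
    exact eval_mono_nat Q (Nat.add_le_add_left (hP x) _)

/-! ### The bound for the distances -/

/-- A base of at least `2` absorbs constants into the exponent: a coefficient `c` is at most `2 ^
c`, and a sum of two terms at most twice the larger. -/
lemma exists_eval_le_pow (P : Polynomial ℕ) : ∃ j, ∀ n, P.eval n ≤ (n + 2) ^ j := by
  induction P using Polynomial.induction_on' with
  | add p q hp hq =>
    obtain ⟨a, ha⟩ := hp
    obtain ⟨b, hb⟩ := hq
    refine ⟨max a b + 1, fun n => ?_⟩
    have h1 : (n + 2) ^ a ≤ (n + 2) ^ max a b := Nat.pow_le_pow_right (by omega) (le_max_left _ _)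
    have h2 : (n + 2) ^ b ≤ (n + 2) ^ max a b :=
      Nat.pow_le_pow_right (by omega) (le_max_right _ _)
    have := ha n
    have := hb n
    rw [Polynomial.eval_add, pow_succ]
    nlinarith
  | monomial k c =>
    refine ⟨c + k, fun n => ?_⟩
    rw [Polynomial.eval_monomial, pow_add]
    refine Nat.mul_le_mul ?_ (Nat.pow_le_pow_left (by omega) _)
    exact (Nat.lt_two_pow_self (n := c)).le.trans (Nat.pow_le_pow_left (by omega) _)

lemma eval_le_mul_pow (p : Polynomial ℝ) :
    ∃ C : ℕ, ∀ n : ℕ, 1 ≤ n → |p.eval (n : ℝ)| ≤ C * (n : ℝ) ^ p.natDegree := by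
  obtain ⟨C, hC⟩ := exists_nat_ge (∑ i ∈ Finset.range (p.natDegree + 1), |p.coeff i|)
  refine ⟨C, fun n hn => ?_⟩
  have hn' : (1 : ℝ) ≤ n := by exact_mod_cast hn
  rw [Polynomial.eval_eq_sum_range]
  refine (Finset.abs_sum_le_sum_abs _ _).trans (le_trans ?_
    (mul_le_mul_of_nonneg_right hC (by positivity)))
  rw [Finset.sum_mul]
  refine Finset.sum_le_sum fun i hi => ?_
  rw [abs_mul, abs_of_nonneg (by positivity : (0 : ℝ) ≤ (n : ℝ) ^ i)]
  exact mul_le_mul_of_nonneg_left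
    (pow_le_pow_right₀ hn' (Nat.lt_succ_iff.1 (Finset.mem_range.1 hi))) (abs_nonneg _)

/-- The asymptotic bound holds from some `n₀` on; the finitely many earlier values are covered by an
additive constant, and all constants are rounded up to natural numbers. -/
lemma PolynomiallySmall.exists_bound {ε : ℕ → ℝ} (hε : PolynomiallySmall ε) :
    ∃ P : Polynomial ℕ, ∀ n, 1 ≤ n → 1 / ε n ≤ (P.eval n : ℕ) := by
  obtain ⟨hpos, p, hp⟩ := hε
  obtain ⟨c, hc⟩ := hp.bound
  obtain ⟨n₀, hn₀⟩ := eventually_atTop.1 hc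
  obtain ⟨A, hA⟩ := exists_nat_ge c
  obtain ⟨C, hC⟩ := eval_le_mul_pow p
  obtain ⟨B, hB⟩ := exists_nat_ge (∑ n ∈ Finset.range n₀, |1 / ε n|)
  refine ⟨Polynomial.C (A * C) * Polynomial.X ^ p.natDegree + Polynomial.C B, fun n hn => ?_⟩
  simp only [Polynomial.eval_add, Polynomial.eval_mul, Polynomial.eval_C, Polynomial.eval_pow,
    Polynomial.eval_X]
  push_cast
  by_cases h : n < n₀
  · have h1 : |1 / ε n| ≤ ∑ n ∈ Finset.range n₀, |1 / ε n| :=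
      Finset.single_le_sum (f := fun n => |1 / ε n|) (fun _ _ => abs_nonneg _)
        (Finset.mem_range.2 h)
    have h2 : (0 : ℝ) ≤ A * C * n ^ p.natDegree := by positivity
    linarith [le_abs_self (1 / ε n)]
  · have h1 := hn₀ n (not_lt.1 h)
    rw [Real.norm_eq_abs, Real.norm_eq_abs] at h1
    have h2 : c * |p.eval (n : ℝ)| ≤ A * (C * n ^ p.natDegree) :=
      mul_le_mul hA (hC n hn) (abs_nonneg _) (by positivity)
    have h3 : (0 : ℝ) ≤ B := by positivity
    have := le_abs_self (1 / ε n)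
    linarith

/-- The number of qubits is coded in unary and each gate takes at least one bit. So the size of the
new register is polynomially bounded in the input through the length of the code. -/
lemma numQubits_add_length_lt (C : Circuit StdGate) :
    C.numQubits + C.gates.length + 1 ≤ (C.code fun _ g => g.code).length := by
  have : C.gates.length ≤ (C.gates.flatMap (fun g => true :: g.code)).length := by
    induction C.gates with
    | nil => simp
    | cons g gs ih => simp at ih ⊢; omega
  simp [Circuit.code, codeNat] at this ⊢
  omega

end SmallQC

end

/-! ### The main theorem: choice of the angle and of the number of runs -/

/-- For every polynomially small `ε`, the restricted quantum computer `QC_ε` can solve every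
problem in BQP in polynomial time. -/
theorem mainTheorem1 (ε : ℕ → ℝ) (hε : SmallQC.PolynomiallySmall ε)
    (yes no : Set (List Bool)) (hBQP : SmallQC.InBQP yes no) :
    SmallQC.SolvableByQC ε yes no := by
  obtain ⟨circ, ⟨hcirc⟩, hyes, hno⟩ := hBQP
  obtain ⟨P, hP⟩ := hε.exists_bound
  obtain ⟨L, hL⟩ := SmallQC.exists_length_le hcirc
  -- This makes `N = (|x| + 2) ^ j` at least `P (L |x|)`, which bounds `1 / ε n` for the register
  -- size `n ≤ L |x|`.
  obtain ⟨j, hj⟩ := SmallQC.exists_eval_le_pow (P.comp L)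
  -- With `72 * (N² + 1)` runs the factor `1 / (N² + 1)` cancels, and the mean number of outcomes
  -- `1` is exactly `72` times the original acceptance probability.
  have hruns : ∀ x : List Bool, (((72 * (((Polynomial.X + 2) ^ j) ^ 2 + 1) :
      Polynomial ℕ).eval x.length : ℕ) : ℝ) * ((SmallQC.smallCircuit ((x.length + 2) ^ j) (circ x)).accProb
        fun _ g => g.toGate) = 72 * (circ x).accProb fun _ g => g.toGate := by
    intro x
    rw [SmallQC.accProb_smallCircuit]
    have : (((x.length + 2) ^ j : ℕ) : ℝ) ^ 2 + 1 ≠ 0 := by positivity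
    simp only [Polynomial.eval_mul, Polynomial.eval_add, Polynomial.eval_pow, Polynomial.eval_X,
      Polynomial.eval_ofNat, Polynomial.eval_one]
    push_cast at this ⊢
    field_simp
  have hq : ∀ x, 0 ≤ ((SmallQC.smallCircuit ((x.length + 2) ^ j) (circ x)).accProb
      fun _ g => g.toGate) ∧ ((SmallQC.smallCircuit ((x.length + 2) ^ j) (circ x)).accProb
      fun _ g => g.toGate) ≤ 1 := by
    intro x
    rw [SmallQC.accProb_smallCircuit]
    have h0 := SmallQC.accProb_nonneg (circ x)
    have h1 := SmallQC.accProb_le_one (circ x)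
    exact ⟨by positivity, div_le_one_of_le₀ (h1.trans (le_add_of_nonneg_left (by positivity)))
      (by positivity)⟩
  refine ⟨fun x => SmallQC.smallCircuit ((x.length + 2) ^ j) (circ x), Polynomial.X,
    72 * (((Polynomial.X + 2) ^ j) ^ 2 + 1), SmallQC.manyOnes,
    SmallQC.smallCircuit_polyTime hcirc j, SmallQC.manyOnes_polyTime, fun x => ?_, fun x => ?_,
    fun x hx => ?_, fun x hx => ?_⟩
  · have hN : 0 < (x.length + 2) ^ j := Nat.pow_pos (by omega)
    refine SmallQC.smallCircuit_mem_QC _ _ ?_ hN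
    have hpos := hε.1 ((circ x).numQubits + (circ x).gates.length + 1) (by omega)
    rw [one_div_le (by exact_mod_cast hN) hpos]
    refine (hP _ (by omega)).trans ?_
    have h1 := hj x.length
    rw [Polynomial.eval_comp] at h1
    exact_mod_cast (SmallQC.eval_mono_nat P
      ((SmallQC.numQubits_add_length_lt (circ x)).trans (hL x))).trans h1
  -- There are `g + 1` gates on `m + g + 1` qubits, so the size polynomial `X` suffices.
  · simp [SmallQC.smallCircuit]
  · refine SmallQC.two_thirds_le_probRuns (hq x).1 (hq x).2 ?_ x
    rw [hruns]
    linarith [hyes x hx]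
  · refine SmallQC.probRuns_le_one_third (hq x).1 (hq x).2 ?_ x
    rw [hruns]
    linarith [hno x hx]
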